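/- **Theorem (Strong completeness of first-order Fischer Servi logic $\mathsf{FOFS}$).** *Language.* A signature consists of a countably infinite set of constants and a countable set of predicate symbols, each with a positive arity. Terms are constants and variables $v_0,v_1,\dots$. Formulas are given by $$\varphi ::= P(t_1,\dots,t_n)\mid s\equiv t\mid \varphi\wedge\varphi\mid\varphi\vee\varphi\mid\varphi\to\varphi\mid\Box\varphi\mid\Diamond\varphi\mid\forall x\,\varphi\mid\exists x\,\varphi\mid\bot ,$$ with $\neg\varphi:=\varphi\to\bot$, $\top:=\neg\bot$, and $\varphi\leftrightarrow\psi:=(\varphi\to\psi)\wedge(\psi\to\varphi)$. A sentence is a formula without free variables. We write $\varphi(x)$ for a formula in which no variable other than $x$ occurs free ($x$ itself need not occur), and $\varphi(c)$ for the sentence obtained by replacing each free occurrence of $x$ by the constant $c$. *Hilbert system.* $\vdash$ is the least set of sentences containing the following axioms and closed under the following rules ($\varphi,\psi$ are sentences where no variable is displayed): * all substitution instances, by sentences, of theorems of intuitionistic propositional logic; * $\Box(\varphi\wedge\psi)\leftrightarrow(\Box\varphi\wedge\Box\psi)$, $\ \Box\top$, $\ \Diamond(\varphi\vee\psi)\leftrightarrow(\Diamond\varphi\vee\Diamond\psi)$,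 $\ \neg\Diamond\bot$; * $(\Diamond\varphi\to\Box\psi)\to\Box(\varphi\to\psi)$ and $\Diamond(\varphi\to\psi)\to(\Box\varphi\to\Diamond\psi)$; * $\forall x\,\varphi(x)\to\varphi(c)$, $\ \varphi(c)\to\exists x\,\varphi(x)$, $\ \forall x(\varphi(x)\to\psi)\to(\exists x\,\varphi(x)\to\psi)$, $\ \forall x(\varphi\to\psi(x))\to(\varphi\to\forall x\,\psi(x))$; * $c\equiv c$, and $c_1\equiv c_2\to(\varphi(c_1)\to\varphi(c_2))$ for $\varphi(x)$ containing neither $\Box$ nor $\Diamond$; * modus ponens; from $\varphi\to\psi$ infer $\Box\varphi\to\Box\psi$ and $\Diamond\varphi\to\Diamond\psi$; from a sentence $\varphi$ infer $\forall x\,\varphi^c_x$, where $\varphi^c_x$ is $\varphi$ with every occurrence of the constant $c$ replaced by $x$, provided that no occurrence of $c$ in $\varphi$ lies in the scope of a quantifier binding $x$. For a set $\Gamma$ of sentences, $\Gamma\vdash\varphi$ means that $\vdash\bigwedge_i\gamma_i\to\varphi$ for some finite $\{\gamma_i\}_i\subseteq\Gamma$, where the empty conjunction is $\top$. *Models.*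 A model consists of * a set $W$ with a partial order $\preccurlyeq$ and a binary relation $M$ such that: if $wMv\preccurlyeq v'$, then $w\preccurlyeq w'Mv'$ for some $w'$; and if $w\preccurlyeq w'$ and $wMv$, then $v\preccurlyeq v'$ and $w'Mv'$ for some $v'$; * a set $D(w)$ for each $w\in W$ with $D(w)\subseteq D(w')$ whenever $w\preccurlyeq w'$ or $wMw'$; * an equivalence relation $\sim_w$ on $D(w)$ for each $w\in W$ with $\sim_w\,\subseteq\,\sim_{w'}$ whenever $w\preccurlyeq w'$; * for each constant $c$ an element $I(c)$ lying in $D(w)$ for every $w$; * for each world $w$ and $n$-ary $P$ a set $I_w(P)\subseteq D(w)^n$, invariant under coordinatewise $\sim_w$, with $I_w(P)\subseteq I_{w'}(P)$ whenever $w\preccurlyeq w'$. Truth $w\Vdash_g\varphi$ is defined for $g:\{v_0,v_1,\dots\}\to D(w)$. Write $t^g$ for the denotation of the term $t$: $c^g=I(c)$ for a constant and $x^g=g(x)$ for a variable. Then $w\Vdash_g P(t_1,\dots,t_n)$ iff $(t_1^g,\dots,t_n^g)\in I_w(P)$, and $w\Vdash_g s\equiv t$ iff $s^g\sim_w t^g$.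 The clauses for $\wedge,\vee,\bot$ are the classical ones. The remaining clauses are: * $w\Vdash_g\varphi\to\psi$ iff for all $w'\succcurlyeq w$, $w'\Vdash_g\varphi$ implies $w'\Vdash_g\psi$; * $w\Vdash_g\Box\varphi$ iff $v\Vdash_g\varphi$ for all $w',v$ with $w\preccurlyeq w'Mv$; * $w\Vdash_g\Diamond\varphi$ iff $v\Vdash_g\varphi$ for some $v$ with $wMv$; * $w\Vdash_g\forall x\,\varphi$ iff $w'\Vdash_{g[x:=a]}\varphi$ for all $w'\succcurlyeq w$ and all $a\in D(w')$; * $w\Vdash_g\exists x\,\varphi$ iff $w\Vdash_{g[x:=a]}\varphi$ for some $a\in D(w)$. A sentence is true at $w$ if it is true at $w$ under every such $g$. $\Gamma\Vdash\varphi$ means that $\varphi$ is true at every world of every model at which all members of $\Gamma$ are true. *Claim.* For every signature, every set $\Gamma$ of sentences and every sentence $\varphi$: if $\Gamma\Vdash\varphi$, then $\Gamma\vdash\varphi$. -/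

import Mathlib

universe u

namespace FOFS

/-! ## The language -/

/-- A signature: a countably infinite set of constants and a countable set of predicate symbols,
each with a positive arity. -/
structure Signature where
  Const : Type u
  Pred : Type u
  arity : Pred → ℕ
  countable_const : Countable Const
  infinite_const : Infinite Const
  countable_pred : Countable Pred
  arity_pos : ∀ P, 0 < arity P

/-- Terms are constants and variables; the variables are `v₀, v₁, …`, indexed by `ℕ`. -/
inductive Term (σ : Signature.{u}) : Type u
  | const (c : σ.Const) : Term σ
  | var (x : ℕ) : Term σ

inductive Formula (σ : Signature.{u}) : Type u
  | rel (P : σ.Pred) (ts : Fin (σ.arity P) → Term σ) : Formula σ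
  | eq (s t : Term σ) : Formula σ
  | and (φ ψ : Formula σ) : Formula σ
  | or (φ ψ : Formula σ) : Formula σ
  | imp (φ ψ : Formula σ) : Formula σ
  | box (φ : Formula σ) : Formula σ
  | dia (φ : Formula σ) : Formula σ
  | all (x : ℕ) (φ : Formula σ) : Formula σ
  | ex (x : ℕ) (φ : Formula σ) : Formula σ
  | bot : Formula σ

variable {σ : Signature.{u}}

namespace Term

def freeVars : Term σ → Finset ℕ
  | const _ => ∅
  | var x => {x}

/-- The term `t` with the variable `x` replaced by the constant `c`. -/
def subst (x : ℕ) (c : σ.Const) : Term σ → Term σ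
  | const d => const d
  | var y => if y = x then const c else var y

/-- The term `t` with the constant `c` replaced by the variable `x`. -/
noncomputable def replaceConst (c : σ.Const) (x : ℕ) : Term σ → Term σ
  | const d => open Classical in if d = c then var x else const d
  | var y => var y

/-- The constant `c` occurs in the term. -/
def HasConst (c : σ.Const) : Term σ → Prop
  | const d => d = c
  | var _ => False

end Term

namespace Formula

def neg (φ : Formula σ) : Formula σ := imp φ bot

def iff (φ ψ : Formula σ) : Formula σ := and (imp φ ψ) (imp ψ φ)

def top : Formula σ := neg bot

/-- The conjunction of a finite list of formulas (`⊤` for the empty list). -/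
def conj : List (Formula σ) → Formula σ
  | [] => top
  | φ :: L => and φ (conj L)

def freeVars : Formula σ → Finset ℕ
  | rel _ ts => Finset.univ.biUnion fun i => (ts i).freeVars
  | eq s t => s.freeVars ∪ t.freeVars
  | and φ ψ => φ.freeVars ∪ ψ.freeVars
  | or φ ψ => φ.freeVars ∪ ψ.freeVars
  | imp φ ψ => φ.freeVars ∪ ψ.freeVars
  | box φ => φ.freeVars
  | dia φ => φ.freeVars
  | all x φ => φ.freeVars.erase x
  | ex x φ => φ.freeVars.erase x
  | bot => ∅

def IsSentence (φ : Formula σ) : Prop := φ.freeVars = ∅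

/-- No variable other than `x` is free in `φ`, so that `φ` may be written `φ(x)`. -/
def FreeOnlyIn (x : ℕ) (φ : Formula σ) : Prop := φ.freeVars ⊆ {x}

/-- `φ(c)`: every free occurrence of the variable `x` in `φ` is replaced by the constant `c`. -/
def subst (x : ℕ) (c : σ.Const) : Formula σ → Formula σ
  | rel P ts => rel P fun i => (ts i).subst x c
  | eq s t => eq (s.subst x c) (t.subst x c)
  | and φ ψ => and (φ.subst x c) (ψ.subst x c)
  | or φ ψ => or (φ.subst x c) (ψ.subst x c)
  | imp φ ψ => imp (φ.subst x c) (ψ.subst x c)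
  | box φ => box (φ.subst x c)
  | dia φ => dia (φ.subst x c)
  | all y φ => if y = x then all y φ else all y (φ.subst x c)
  | ex y φ => if y = x then ex y φ else ex y (φ.subst x c)
  | bot => bot

/-- `φ` with each occurrence of the constant `c` replaced by the variable `x`. -/
noncomputable def replaceConst (c : σ.Const) (x : ℕ) : Formula σ → Formula σ
  | rel P ts => rel P fun i => (ts i).replaceConst c x
  | eq s t => eq (s.replaceConst c x) (t.replaceConst c x)
  | and φ ψ => and (φ.replaceConst c x) (ψ.replaceConst c x)
  | or φ ψ => or (φ.replaceConst c x) (ψ.replaceConst c x)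
  | imp φ ψ => imp (φ.replaceConst c x) (ψ.replaceConst c x)
  | box φ => box (φ.replaceConst c x)
  | dia φ => dia (φ.replaceConst c x)
  | all y φ => all y (φ.replaceConst c x)
  | ex y φ => ex y (φ.replaceConst c x)
  | bot => bot

/-- The constant `c` occurs in the formula. -/
def HasConst (c : σ.Const) : Formula σ → Prop
  | rel _ ts => ∃ i, (ts i).HasConst c
  | eq s t => s.HasConst c ∨ t.HasConst c
  | and φ ψ => φ.HasConst c ∨ ψ.HasConst c
  | or φ ψ => φ.HasConst c ∨ ψ.HasConst c
  | imp φ ψ => φ.HasConst c ∨ ψ.HasConst c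
  | box φ => φ.HasConst c
  | dia φ => φ.HasConst c
  | all _ φ => φ.HasConst c
  | ex _ φ => φ.HasConst c
  | bot => False

/-- The variable `x` is substitutable for the constant `c`: no occurrence of `c` lies in the
scope of a quantifier that binds `x`. -/
def Substitutable (x : ℕ) (c : σ.Const) : Formula σ → Prop
  | rel _ _ => True
  | eq _ _ => True
  | and φ ψ => φ.Substitutable x c ∧ ψ.Substitutable x c
  | or φ ψ => φ.Substitutable x c ∧ ψ.Substitutable x c
  | imp φ ψ => φ.Substitutable x c ∧ ψ.Substitutable x c
  | box φ => φ.Substitutable x c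
  | dia φ => φ.Substitutable x c
  | all y φ => (y = x → ¬ φ.HasConst c) ∧ φ.Substitutable x c
  | ex y φ => (y = x → ¬ φ.HasConst c) ∧ φ.Substitutable x c
  | bot => True

/-- Neither `□` nor `◇` occurs in the formula. -/
def ModalFree : Formula σ → Prop
  | rel _ _ => True
  | eq _ _ => True
  | and φ ψ => φ.ModalFree ∧ ψ.ModalFree
  | or φ ψ => φ.ModalFree ∧ ψ.ModalFree
  | imp φ ψ => φ.ModalFree ∧ ψ.ModalFree
  | box _ => False
  | dia _ => False
  | all _ φ => φ.ModalFree
  | ex _ φ => φ.ModalFree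
  | bot => True

end Formula

/-! ## Intuitionistic propositional logic -/

inductive PropFormula : Type
  | atom (n : ℕ) : PropFormula
  | and (A B : PropFormula) : PropFormula
  | or (A B : PropFormula) : PropFormula
  | imp (A B : PropFormula) : PropFormula
  | bot : PropFormula

/-- The theorems of intuitionistic propositional logic, by the usual Hilbert system. -/
inductive IPC : PropFormula → Prop
  | k (A B : PropFormula) : IPC (.imp A (.imp B A))
  | s (A B C : PropFormula) :
      IPC (.imp (.imp A (.imp B C)) (.imp (.imp A B) (.imp A C)))
  | and_left (A B : PropFormula) : IPC (.imp (.and A B) A)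
  | and_right (A B : PropFormula) : IPC (.imp (.and A B) B)
  | and_intro (A B : PropFormula) : IPC (.imp A (.imp B (.and A B)))
  | or_left (A B : PropFormula) : IPC (.imp A (.or A B))
  | or_right (A B : PropFormula) : IPC (.imp B (.or A B))
  | or_elim (A B C : PropFormula) :
      IPC (.imp (.imp A C) (.imp (.imp B C) (.imp (.or A B) C)))
  | exfalso (A : PropFormula) : IPC (.imp .bot A)
  | mp {A B : PropFormula} : IPC (.imp A B) → IPC A → IPC B

/-- The substitution instance of a propositional formula in which the `n`-th atom is replaced
by `θ n`. -/
def PropFormula.inst (θ : ℕ → Formula σ) : PropFormula → Formula σ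
  | atom n => θ n
  | and A B => .and (A.inst θ) (B.inst θ)
  | or A B => .or (A.inst θ) (B.inst θ)
  | imp A B => .imp (A.inst θ) (B.inst θ)
  | bot => .bot

/-! ## The Hilbert system -/

open Formula in
/-- `Thm φ`: the sentence `φ` is a theorem of first-order Fischer Servi logic. -/
inductive Thm : Formula σ → Prop
  | intuit (A : PropFormula) (θ : ℕ → Formula σ) (hA : IPC A) (hθ : ∀ n, (θ n).IsSentence) :
      Thm (A.inst θ)
  | box_and (φ ψ : Formula σ) (hφ : φ.IsSentence) (hψ : ψ.IsSentence) :
      Thm (iff (box (and φ ψ)) (and (box φ) (box ψ)))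
  | box_top : Thm (box top)
  | dia_or (φ ψ : Formula σ) (hφ : φ.IsSentence) (hψ : ψ.IsSentence) :
      Thm (iff (dia (or φ ψ)) (or (dia φ) (dia ψ)))
  | dia_bot : Thm (neg (dia bot))
  | fs1 (φ ψ : Formula σ) (hφ : φ.IsSentence) (hψ : ψ.IsSentence) :
      Thm (imp (imp (dia φ) (box ψ)) (box (imp φ ψ)))
  | fs2 (φ ψ : Formula σ) (hφ : φ.IsSentence) (hψ : ψ.IsSentence) :
      Thm (imp (dia (imp φ ψ)) (imp (box φ) (dia ψ)))
  | univ (x : ℕ) (φ : Formula σ) (c : σ.Const) (hφ : φ.FreeOnlyIn x) :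
      Thm (imp (all x φ) (φ.subst x c))
  | exist (x : ℕ) (φ : Formula σ) (c : σ.Const) (hφ : φ.FreeOnlyIn x) :
      Thm (imp (φ.subst x c) (ex x φ))
  | all_ex (x : ℕ) (φ ψ : Formula σ) (hφ : φ.FreeOnlyIn x) (hψ : ψ.IsSentence) :
      Thm (imp (all x (imp φ ψ)) (imp (ex x φ) ψ))
  | all_imp (x : ℕ) (φ ψ : Formula σ) (hφ : φ.IsSentence) (hψ : ψ.FreeOnlyIn x) :
      Thm (imp (all x (imp φ ψ)) (imp φ (all x ψ)))
  | id_refl (c : σ.Const) : Thm (eq (.const c) (.const c))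
  | id_sub (x : ℕ) (φ : Formula σ) (c₁ c₂ : σ.Const) (hφ : φ.FreeOnlyIn x)
      (hm : φ.ModalFree) :
      Thm (imp (eq (.const c₁) (.const c₂)) (imp (φ.subst x c₁) (φ.subst x c₂)))
  | mp {φ ψ : Formula σ} : Thm (imp φ ψ) → Thm φ → Thm ψ
  | gen (x : ℕ) (c : σ.Const) {φ : Formula σ} (hs : φ.Substitutable x c) :
      Thm φ → Thm (all x (φ.replaceConst c x))
  | reg_box {φ ψ : Formula σ} : Thm (imp φ ψ) → Thm (imp (box φ) (box ψ))
  | reg_dia {φ ψ : Formula σ} : Thm (imp φ ψ) → Thm (imp (dia φ) (dia ψ))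

/-- `Γ ⊢ φ`: some finite conjunction of members of `Γ` provably implies `φ`. -/
def Proves (Γ : Set (Formula σ)) (φ : Formula σ) : Prop :=
  ∃ L : List (Formula σ), (∀ γ ∈ L, γ ∈ Γ) ∧ Thm (.imp (Formula.conj L) φ)

/-! ## Birelational semantics -/

/-- Fischer Servi frames. The intuitionistic relation is the partial order `≤` on worlds and
`M` is the modal relation. -/
structure FSFrame where
  World : Type u
  order : PartialOrder World
  M : World → World → Prop
  fc1 : ∀ w v v', M w v → v ≤ v' → ∃ w', w ≤ w' ∧ M w' v'
  fc2 : ∀ w w' v, w ≤ w' → M w v → ∃ v', v ≤ v' ∧ M w' v'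

attribute [instance] FSFrame.order

/-- Frames with a domain system: each world `w` carries a domain `D w` (domains expand along both
relations) and an equivalence relation `E w` on `D w` (persistent along `≤` only). -/
structure Frame extends FSFrame.{u} where
  Elem : Type u
  D : World → Set Elem
  D_le : ∀ w w', w ≤ w' → D w ⊆ D w'
  D_M : ∀ w v, M w v → D w ⊆ D v
  E : World → Elem → Elem → Prop
  E_dom : ∀ w a b, E w a b → a ∈ D w ∧ b ∈ D w
  E_refl : ∀ w, ∀ a ∈ D w, E w a a
  E_symm : ∀ w a b, E w a b → E w b a
  E_trans : ∀ w a b c, E w a b → E w b c → E w a c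
  E_le : ∀ w w' a b, w ≤ w' → E w a b → E w' a b

/-- Models: constants are interpreted rigidly, by elements of every domain; predicates are
interpreted world by world, persistently and compatibly with the relations `E w`. -/
structure Model (σ : Signature.{u}) extends Frame.{u} where
  constI : σ.Const → Elem
  constI_mem : ∀ c w, constI c ∈ D w
  predI : World → (P : σ.Pred) → Set (Fin (σ.arity P) → Elem)
  predI_dom : ∀ w P, ∀ a ∈ predI w P, ∀ i, a i ∈ D w
  predI_le : ∀ w w' P, w ≤ w' → predI w P ⊆ predI w' P
  predI_E : ∀ w P a b, (∀ i, E w (a i) (b i)) → a ∈ predI w P → b ∈ predI w P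

namespace Model

variable (𝔐 : Model.{u} σ)

/-- `g` is a `w`-variable assignment. -/
def IsVA (w : 𝔐.World) (g : ℕ → 𝔐.Elem) : Prop := ∀ x, g x ∈ 𝔐.D w

def den (g : ℕ → 𝔐.Elem) : Term σ → 𝔐.Elem
  | .const c => 𝔐.constI c
  | .var x => g x

/-- Truth of a formula at the world `w` relative to the assignment `g`. -/
def Sat (w : 𝔐.World) (g : ℕ → 𝔐.Elem) : Formula σ → Prop
  | .rel P ts => (fun i => 𝔐.den g (ts i)) ∈ 𝔐.predI w P
  | .eq s t => 𝔐.E w (𝔐.den g s) (𝔐.den g t)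
  | .and φ ψ => Sat w g φ ∧ Sat w g ψ
  | .or φ ψ => Sat w g φ ∨ Sat w g ψ
  | .imp φ ψ => ∀ w', w ≤ w' → Sat w' g φ → Sat w' g ψ
  | .box φ => ∀ w' v', w ≤ w' → 𝔐.M w' v' → Sat v' g φ
  | .dia φ => ∃ v, 𝔐.M w v ∧ Sat v g φ
  | .all x φ => ∀ w', w ≤ w' → ∀ a ∈ 𝔐.D w', Sat w' (Function.update g x a) φ
  | .ex x φ => ∃ a ∈ 𝔐.D w, Sat w (Function.update g x a) φ
  | .bot => False

/-- Truth of a sentence at a world: truth relative to each `w`-variable assignment. -/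
def Holds (w : 𝔐.World) (φ : Formula σ) : Prop := ∀ g, 𝔐.IsVA w g → 𝔐.Sat w g φ

end Model

/-- `Γ ⊩ φ`: at every world of every model where all of `Γ` is true, `φ` is true. -/
def Entails (Γ : Set (Formula σ)) (φ : Formula σ) : Prop :=
  ∀ (𝔐 : Model.{u} σ) (w : 𝔐.World), (∀ γ ∈ Γ, 𝔐.Holds w γ) → 𝔐.Holds w φ

end FOFS

/-!
By contraposition, a model refuting `φ` is built from prime theories with Henkin witnesses. Since
`≤` and `M` have to commute in two ways and domains have to grow along both, a world is not just a
prime theory but a finite path `T₀ M T₁ M ⋯ M Tₙ` of prime theories, and `≤` extends all theories of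
a path at once. Then `w M v ≤ v'` is completed by cutting off the last theory of `v'`, and the
difficulty moves to Lindenbaum's lemma, which has to extend all theories of a path simultaneously
while keeping them related by `M`. The invariant preserved there is that the path has no refutation,
that is, no sentences `⊤ = D₀, D₁, …, Dₙ` such that the `i`-th theory proves `Dᵢ → □Dᵢ₊₁`, with
`Dᵢ₊₁` in its own language, and the last one proves `Dₙ → ψ`, where `ψ` is the sentence to be
omitted. As languages grow along a path, a fresh constant of the `j`-th language occurs in no
earlier one, so that witnesses for `∃` can be added at any place.

When the theories of a path are extended, so are their languages. Consequences are pulled back to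
the old languages by projections: existentially quantifying the unwanted constants of a sentence
yields its strongest consequence without them.

The original constants are first moved into a part of the language that leaves infinitely many
spare; a proof in the enlarged language is moved back by a left inverse of this embedding.
-/

namespace FOFS

variable {σ : Signature.{u}}

/-! ## Syntax -/

instance : Countable σ.Const := σ.countable_const

instance : Countable σ.Pred := σ.countable_pred

instance : Countable (Term σ) :=
  Function.Injective.countable (β := σ.Const ⊕ ℕ)
    (f := fun | .const c => .inl c | .var x => .inr x) fun s t h => by
      cases s <;> cases t <;> simp_all

/-- The atomic formulas other than `⊥`, used to number all formulas. -/
abbrev Atom (σ : Signature.{u}) : Type u :=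
  ((P : σ.Pred) × (Fin (σ.arity P) → Term σ)) ⊕ Term σ × Term σ

namespace Formula

/-- The Gödel number of a formula, for a numbering `a` of the atomic formulas. -/
def code (a : Atom σ → ℕ) : Formula σ → ℕ
  | rel P ts => .pair 0 (a (.inl ⟨P, ts⟩))
  | eq s t => .pair 1 (a (.inr (s, t)))
  | and φ ψ => .pair 2 (.pair (φ.code a) (ψ.code a))
  | or φ ψ => .pair 3 (.pair (φ.code a) (ψ.code a))
  | imp φ ψ => .pair 4 (.pair (φ.code a) (ψ.code a))
  | box φ => .pair 5 (φ.code a)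
  | dia φ => .pair 6 (φ.code a)
  | all x φ => .pair 7 (.pair x (φ.code a))
  | ex x φ => .pair 8 (.pair x (φ.code a))
  | bot => .pair 9 0

theorem code_injective {a : Atom σ → ℕ} (ha : Function.Injective a) :
    Function.Injective (code a) := by
  intro φ ψ h
  induction φ generalizing ψ <;> cases ψ <;>
    simp only [code, Nat.pair_eq_pair, ha.eq_iff, reduceCtorEq] at h <;> grind

instance : Countable (Formula σ) :=
  have ⟨_, ha⟩ := exists_injective_nat (Atom σ)
  (code_injective ha).countable

end Formula

namespace Term

/-- The term with every constant `c` replaced by `f c`. -/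
def rename (f : σ.Const → σ.Const) : Term σ → Term σ
  | const c => const (f c)
  | var x => var x

/-- The term with each variable `x` replaced by the constant `ρ x`, if there is one. -/
def inst (ρ : ℕ → Option σ.Const) : Term σ → Term σ
  | const c => const c
  | var x => (ρ x).elim (var x) const

variable {f : σ.Const → σ.Const} {ρ : ℕ → Option σ.Const} {x : ℕ} {c d : σ.Const} {t : Term σ}

theorem subst_eq_inst :
    t.subst x c = t.inst (Function.update (fun _ => none) x (some c)) := by
  cases t with
  | const d => rfl
  | var y => by_cases h : y = x <;> simp [subst, inst, h]

theorem mem_freeVars_inst {y : ℕ} : y ∈ (t.inst ρ).freeVars ↔ y ∈ t.freeVars ∧ ρ y = none := by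
  cases t with
  | const d => simp [inst, freeVars]
  | var z => cases h : ρ z <;> simp only [inst, freeVars, h] <;> grind [freeVars]

theorem HasConst.of_inst (h : (t.inst ρ).HasConst c) : t.HasConst c ∨ ∃ x, ρ x = some c := by
  cases t with
  | const d => exact Or.inl h
  | var z => cases hz : ρ z <;> simp only [inst, hz] at h <;> grind [HasConst]

theorem inst_eq_self (h : ∀ x ∈ t.freeVars, ρ x = none) : t.inst ρ = t := by
  cases t with
  | const d => rfl
  | var z => simp [inst, h z (by simp [freeVars])]

theorem inst_subst (ρ : ℕ → Option σ.Const) (x : ℕ) (c : σ.Const) (t : Term σ) :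
    (t.inst (Function.update ρ x none)).subst x c = t.inst (Function.update ρ x (some c)) := by
  cases t with
  | const d => rfl
  | var y =>
    by_cases hy : y = x
    · subst hy; simp [inst, subst]
    · cases hρ : ρ y <;> simp [inst, subst, hy, hρ]

theorem freeVars_replaceConst : (t.replaceConst c x).freeVars ⊆ insert x t.freeVars := by
  grind [cases Term, replaceConst, freeVars]

theorem HasConst.of_replaceConst (h : (t.replaceConst c x).HasConst d) :
    t.HasConst d ∧ d ≠ c := by
  grind [cases Term, replaceConst, HasConst]

theorem replaceConst_of_not_hasConst (h : ¬ t.HasConst c) : t.replaceConst c x = t := by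
  grind [cases Term, replaceConst, HasConst]

theorem replaceConst_subst (h : ¬ t.HasConst c) : (t.subst x c).replaceConst c x = t := by
  grind [cases Term, subst, replaceConst, HasConst]

theorem subst_replaceConst (h : x ∉ t.freeVars) : (t.replaceConst c x).subst x c = t := by
  grind [cases Term, subst, replaceConst, freeVars]

theorem finite_hasConst (t : Term σ) : {c | t.HasConst c}.Finite := by
  cases t with
  | const d => exact Set.finite_singleton d |>.subset fun c hc => Eq.symm hc
  | var y => exact Set.finite_empty

theorem rename_subst : (t.subst x c).rename f = (t.rename f).subst x (f c) := by
  grind [cases Term, subst, rename]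

theorem freeVars_rename : (t.rename f).freeVars = t.freeVars := by
  cases t <;> rfl

theorem hasConst_rename : (t.rename f).HasConst d ↔ ∃ c, t.HasConst c ∧ f c = d := by
  cases t <;> simp [rename, HasConst]

theorem rename_rename (g : σ.Const → σ.Const) : (t.rename f).rename g = t.rename (g ∘ f) := by
  cases t <;> rfl

theorem rename_id : t.rename id = t := by
  cases t <;> rfl

theorem replaceConst_rename_update [DecidableEq σ.Const] {c' : σ.Const}
    (h : ∀ d, t.HasConst d → d ≠ c → f d ≠ c') :
    (t.rename (Function.update f c c')).replaceConst c' x = (t.replaceConst c x).rename f := by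
  grind [cases Term, replaceConst, rename, HasConst, Function.update_self, Function.update_of_ne]

end Term

namespace Formula

/-- The formula with every constant `c` replaced by `f c`. -/
def rename (f : σ.Const → σ.Const) : Formula σ → Formula σ
  | rel P ts => rel P fun i => (ts i).rename f
  | eq s t => eq (s.rename f) (t.rename f)
  | and φ ψ => and (φ.rename f) (ψ.rename f)
  | or φ ψ => or (φ.rename f) (ψ.rename f)
  | imp φ ψ => imp (φ.rename f) (ψ.rename f)
  | box φ => box (φ.rename f)
  | dia φ => dia (φ.rename f)
  | all y φ => all y (φ.rename f)
  | ex y φ => ex y (φ.rename f)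
  | bot => bot

/-- The formula with each free variable `x` replaced by the constant `ρ x`, if there is one. -/
def inst (ρ : ℕ → Option σ.Const) : Formula σ → Formula σ
  | rel P ts => rel P fun i => (ts i).inst ρ
  | eq s t => eq (s.inst ρ) (t.inst ρ)
  | and φ ψ => and (φ.inst ρ) (ψ.inst ρ)
  | or φ ψ => or (φ.inst ρ) (ψ.inst ρ)
  | imp φ ψ => imp (φ.inst ρ) (ψ.inst ρ)
  | box φ => box (φ.inst ρ)
  | dia φ => dia (φ.inst ρ)
  | all y φ => all y (φ.inst (Function.update ρ y none))
  | ex y φ => ex y (φ.inst (Function.update ρ y none))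
  | bot => bot

/-- All variables of the formula, free or bound. -/
def vars : Formula σ → Finset ℕ
  | rel _ ts => Finset.univ.biUnion fun i => (ts i).freeVars
  | eq s t => s.freeVars ∪ t.freeVars
  | and φ ψ => φ.vars ∪ ψ.vars
  | or φ ψ => φ.vars ∪ ψ.vars
  | imp φ ψ => φ.vars ∪ ψ.vars
  | box φ => φ.vars
  | dia φ => φ.vars
  | all x φ => insert x φ.vars
  | ex x φ => insert x φ.vars
  | bot => ∅

variable {f : σ.Const → σ.Const} {ρ : ℕ → Option σ.Const} {x : ℕ} {c d : σ.Const}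
  {φ ψ : Formula σ}

theorem mem_freeVars_inst {y : ℕ} : y ∈ (φ.inst ρ).freeVars ↔ y ∈ φ.freeVars ∧ ρ y = none := by
  induction φ generalizing ρ with
  | rel P ts => simp [inst, freeVars, Term.mem_freeVars_inst]
  | all z φ ih | ex z φ ih => by_cases hy : y = z <;> simp [inst, freeVars, ih, hy]
  | _ => grind [inst, freeVars, Term.mem_freeVars_inst]

theorem HasConst.of_inst (h : (φ.inst ρ).HasConst c) : φ.HasConst c ∨ ∃ x, ρ x = some c := by
  induction φ generalizing ρ with
  | all y φ ih | ex y φ ih =>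
    refine (ih h).imp_right fun ⟨x, hx⟩ => ⟨x, ?_⟩
    by_cases hy : x = y <;> simp_all
  | _ => grind [inst, HasConst, Term.HasConst.of_inst]

theorem inst_eq_self (h : ∀ x ∈ φ.freeVars, ρ x = none) : φ.inst ρ = φ := by
  induction φ generalizing ρ with
  | rel P ts =>
    simp only [inst, rel.injEq, heq_eq_eq, true_and]
    exact funext fun i => Term.inst_eq_self fun x hx => h x (by simpa [freeVars] using ⟨i, hx⟩)
  | all y φ ih | ex y φ ih =>
    simp only [inst]
    rw [ih fun x hx => ?_]
    by_cases hy : x = y <;> simp_all [freeVars]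
  | _ => grind [inst, freeVars, Term.inst_eq_self]

theorem subst_eq_inst :
    φ.subst x c = φ.inst (Function.update (fun _ => none) x (some c)) := by
  induction φ with
  | all y φ ih | ex y φ ih =>
    by_cases hy : y = x
    · simp [subst, inst, hy, inst_eq_self]
    · have hupdate := Function.update_comm (Ne.symm hy) (some c) none fun _ => none
      simp [subst, inst, hy, ih, hupdate]
  | _ => simp_all [subst, inst, Term.subst_eq_inst]

theorem inst_subst (ρ : ℕ → Option σ.Const) (x : ℕ) (c : σ.Const) (φ : Formula σ) :
    (φ.inst (Function.update ρ x none)).subst x c = φ.inst (Function.update ρ x (some c)) := by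
  induction φ generalizing ρ with
  | all y φ ih | ex y φ ih =>
    by_cases hy : y = x
    · simp [subst, inst, hy]
    · simp only [subst, inst, hy, if_false]
      rw [Function.update_comm (Ne.symm hy), ih, Function.update_comm hy]
  | _ => simp_all [subst, inst, Term.inst_subst]

theorem freeVars_subst : (φ.subst x c).freeVars = φ.freeVars.erase x := by
  ext y
  rw [subst_eq_inst, mem_freeVars_inst]
  by_cases hy : y = x <;> simp [hy]

theorem HasConst.of_subst (h : (φ.subst x c).HasConst d) : φ.HasConst d ∨ d = c := by
  rw [subst_eq_inst] at h
  refine h.of_inst.imp_right fun ⟨y, hy⟩ => ?_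
  by_cases hyx : y = x <;> simp_all

theorem subst_eq_self (h : x ∉ φ.freeVars) : φ.subst x c = φ := by
  rw [subst_eq_inst, inst_eq_self]
  exact fun y hy => Function.update_of_ne (ne_of_mem_of_not_mem hy h) ..

theorem freeVars_replaceConst : (φ.replaceConst c x).freeVars ⊆ insert x φ.freeVars := by
  induction φ with
  | rel P ts =>
    simp only [replaceConst, freeVars, Finset.biUnion_subset]
    intro i _ y hy
    have := Term.freeVars_replaceConst hy
    grind
  | _ => grind [replaceConst, freeVars, Term.freeVars_replaceConst]

theorem HasConst.of_replaceConst (h : (φ.replaceConst c x).HasConst d) :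
    φ.HasConst d ∧ d ≠ c := by
  induction φ with
  | rel P ts =>
    obtain ⟨i, hi⟩ := h
    exact ⟨⟨i, hi.of_replaceConst.1⟩, hi.of_replaceConst.2⟩
  | _ => grind [replaceConst, HasConst, Term.HasConst.of_replaceConst]

theorem replaceConst_of_not_hasConst (h : ¬ φ.HasConst c) : φ.replaceConst c x = φ := by
  induction φ <;>
    simp_all [replaceConst, HasConst, Term.replaceConst_of_not_hasConst]

theorem replaceConst_subst (h : ¬ φ.HasConst c) : (φ.subst x c).replaceConst c x = φ := by
  induction φ with
  | all y φ ih | ex y φ ih =>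
    by_cases hy : y = x
    · simpa [subst, hy] using replaceConst_of_not_hasConst h
    · simp [subst, hy, replaceConst, ih h]
  | _ => simp_all [subst, replaceConst, HasConst, Term.replaceConst_subst]

theorem subst_replaceConst (h : x ∉ φ.vars) : (φ.replaceConst c x).subst x c = φ := by
  induction φ <;> simp_all [subst, replaceConst, vars, Term.subst_replaceConst, Ne.symm]

theorem substitutable_of_not_hasConst (h : ¬ φ.HasConst c) : φ.Substitutable x c := by
  induction φ <;> simp_all [Substitutable, HasConst]

theorem substitutable_subst (h : ¬ φ.HasConst c) : (φ.subst x c).Substitutable x c := by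
  induction φ with
  | all y φ ih | ex y φ ih =>
    by_cases hy : y = x
    · simpa [subst, hy] using substitutable_of_not_hasConst h
    · simpa [subst, hy, Substitutable] using ih h
  | _ => simp_all [subst, Substitutable, HasConst]

theorem finite_hasConst (φ : Formula σ) : {c | φ.HasConst c}.Finite := by
  induction φ with
  | rel P ts =>
    exact (Set.finite_iUnion fun i => (ts i).finite_hasConst).subset fun c hc => by
      simpa [HasConst] using hc
  | eq s t => exact s.finite_hasConst.union t.finite_hasConst
  | and φ ψ h1 h2 | or φ ψ h1 h2 | imp φ ψ h1 h2 => exact h1.union h2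
  | box _ ih | dia _ ih | all _ _ ih | ex _ _ ih => exact ih
  | bot => exact Set.finite_empty

theorem rename_subst : (φ.subst x c).rename f = (φ.rename f).subst x (f c) := by
  induction φ with
  | all y φ ih | ex y φ ih => by_cases hy : y = x <;> simp [subst, rename, hy, ih]
  | _ => simp_all [subst, rename, Term.rename_subst]

theorem freeVars_rename : (φ.rename f).freeVars = φ.freeVars := by
  induction φ <;> simp_all [rename, freeVars, Term.freeVars_rename]

theorem IsSentence.rename (h : φ.IsSentence) : (φ.rename f).IsSentence :=
  freeVars_rename.trans h

theorem FreeOnlyIn.rename (h : φ.FreeOnlyIn x) : (φ.rename f).FreeOnlyIn x :=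
  freeVars_rename.trans_subset h

theorem ModalFree.rename (h : φ.ModalFree) : (φ.rename f).ModalFree := by
  induction φ <;> simp_all [Formula.rename, ModalFree]

theorem hasConst_rename : (φ.rename f).HasConst d ↔ ∃ c, φ.HasConst c ∧ f c = d := by
  induction φ with
  | rel P ts =>
    simp only [rename, HasConst, Term.hasConst_rename]
    grind
  | _ => simp_all [rename, HasConst, Term.hasConst_rename, or_and_right, exists_or]

theorem rename_rename (g : σ.Const → σ.Const) : (φ.rename f).rename g = φ.rename (g ∘ f) := by
  induction φ <;> simp_all [rename, Term.rename_rename]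

theorem rename_id : φ.rename id = φ := by
  induction φ <;> simp_all [rename, Term.rename_id]

section

variable [DecidableEq σ.Const] {c' : σ.Const}

theorem replaceConst_rename_update (h : ∀ d, φ.HasConst d → d ≠ c → f d ≠ c') :
    (φ.rename (Function.update f c c')).replaceConst c' x = (φ.replaceConst c x).rename f := by
  induction φ with
  | rel P ts =>
    simp only [rename, replaceConst, rel.injEq, heq_eq_eq, true_and]
    exact funext fun i => Term.replaceConst_rename_update fun d hd => h d ⟨i, hd⟩
  | _ => grind [rename, replaceConst, HasConst, Term.replaceConst_rename_update]

theorem not_hasConst_rename_update (h : ∀ d, φ.HasConst d → d ≠ c → f d ≠ c')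
    (hc : ¬ φ.HasConst c) : ¬ (φ.rename (Function.update f c c')).HasConst c' := by
  rw [hasConst_rename]
  rintro ⟨d, hd, hdc'⟩
  have hdc : d ≠ c := fun h => hc (h ▸ hd)
  exact h d hd hdc (by rwa [Function.update_of_ne hdc] at hdc')

theorem Substitutable.rename_update (h : ∀ d, φ.HasConst d → d ≠ c → f d ≠ c')
    (hs : φ.Substitutable x c) : (φ.rename (Function.update f c c')).Substitutable x c' := by
  induction φ with
  | all y φ ih | ex y φ ih =>
    exact ⟨fun hy => not_hasConst_rename_update h (hs.1 hy), ih h hs.2⟩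
  | _ => grind [Formula.rename, Substitutable, HasConst]

end

/-! ### Sentences -/

theorem IsSentence.subst_eq (h : φ.IsSentence) : φ.subst x c = φ :=
  subst_eq_self (by rw [IsSentence] at h; simp [h])

@[simp] theorem isSentence_bot : (bot : Formula σ).IsSentence := rfl

@[simp] theorem isSentence_top : (top : Formula σ).IsSentence := rfl

@[simp] theorem isSentence_eq_const : (eq (.const c) (.const d) : Formula σ).IsSentence := rfl

@[simp] theorem isSentence_rel_const {P : σ.Pred} {a : Fin (σ.arity P) → σ.Const} :
    (rel P fun i => .const (a i)).IsSentence := by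
  ext
  simp [freeVars, Term.freeVars]

@[simp] theorem isSentence_and : (and φ ψ).IsSentence ↔ φ.IsSentence ∧ ψ.IsSentence :=
  Finset.union_eq_empty

@[simp] theorem isSentence_or : (or φ ψ).IsSentence ↔ φ.IsSentence ∧ ψ.IsSentence :=
  Finset.union_eq_empty

@[simp] theorem isSentence_imp : (imp φ ψ).IsSentence ↔ φ.IsSentence ∧ ψ.IsSentence :=
  Finset.union_eq_empty

@[simp] theorem isSentence_box : (box φ).IsSentence ↔ φ.IsSentence := Iff.rfl

@[simp] theorem isSentence_dia : (dia φ).IsSentence ↔ φ.IsSentence := Iff.rfl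

@[simp] theorem isSentence_all : (all x φ).IsSentence ↔ φ.FreeOnlyIn x := by
  simp [IsSentence, FreeOnlyIn, freeVars, Finset.erase_eq_empty_iff, Finset.subset_singleton_iff]

@[simp] theorem isSentence_ex : (ex x φ).IsSentence ↔ φ.FreeOnlyIn x := isSentence_all

theorem IsSentence.freeOnlyIn (h : φ.IsSentence) : φ.FreeOnlyIn x :=
  h.trans_subset (Finset.empty_subset _)

theorem FreeOnlyIn.imp (hφ : φ.FreeOnlyIn x) (hψ : ψ.FreeOnlyIn x) :
    (imp φ ψ).FreeOnlyIn x :=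
  Finset.union_subset hφ hψ

theorem FreeOnlyIn.isSentence_subst (h : φ.FreeOnlyIn x) : (φ.subst x c).IsSentence :=
  freeVars_subst.trans (isSentence_all.2 h)

theorem IsSentence.freeOnlyIn_replaceConst (h : φ.IsSentence) :
    (φ.replaceConst c x).FreeOnlyIn x := by
  simpa [FreeOnlyIn, show φ.freeVars = ∅ from h] using freeVars_replaceConst (φ := φ)

/-- The sentences all of whose constants lie in `S`. -/
def sentences (S : Set σ.Const) : Set (Formula σ) :=
  {φ | φ.IsSentence ∧ ∀ c, φ.HasConst c → c ∈ S}

variable {S T : Set σ.Const}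

theorem sentences_mono (h : S ⊆ T) : sentences S ⊆ sentences T :=
  fun _ hφ => ⟨hφ.1, fun c hc => h (hφ.2 c hc)⟩

theorem eq_const_mem_sentences : eq (.const c) (.const d) ∈ sentences S ↔ c ∈ S ∧ d ∈ S := by
  refine ⟨fun h => ⟨h.2 c (.inl rfl), h.2 d (.inr rfl)⟩, fun h => ⟨isSentence_eq_const, ?_⟩⟩
  rintro _ (rfl | rfl)
  exacts [h.1, h.2]

theorem rel_const_mem_sentences {P : σ.Pred} {a : Fin (σ.arity P) → σ.Const} :
    (rel P fun i => .const (a i)) ∈ sentences S ↔ ∀ i, a i ∈ S := by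
  refine ⟨fun h i => h.2 (a i) ⟨i, rfl⟩, fun h => ⟨isSentence_rel_const, ?_⟩⟩
  rintro _ ⟨i, rfl⟩
  exact h i

theorem and_mem_sentences : and φ ψ ∈ sentences S ↔ φ ∈ sentences S ∧ ψ ∈ sentences S := by
  simp only [sentences, Set.mem_ofPred_eq, isSentence_and, HasConst, or_imp, forall_and]
  tauto

theorem or_mem_sentences : or φ ψ ∈ sentences S ↔ φ ∈ sentences S ∧ ψ ∈ sentences S :=
  and_mem_sentences

theorem imp_mem_sentences : imp φ ψ ∈ sentences S ↔ φ ∈ sentences S ∧ ψ ∈ sentences S :=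
  and_mem_sentences

theorem box_mem_sentences : box φ ∈ sentences S ↔ φ ∈ sentences S := Iff.rfl

theorem dia_mem_sentences : dia φ ∈ sentences S ↔ φ ∈ sentences S := Iff.rfl

theorem bot_mem_sentences : bot ∈ sentences S := ⟨rfl, fun _ h => h.elim⟩

theorem top_mem_sentences : top ∈ sentences S :=
  imp_mem_sentences.2 ⟨bot_mem_sentences, bot_mem_sentences⟩

theorem subst_mem_sentences (h : all x φ ∈ sentences S) (hc : c ∈ S) :
    φ.subst x c ∈ sentences S :=
  ⟨(isSentence_all.1 h.1).isSentence_subst, fun d hd => hd.of_subst.elim (h.2 d) fun e => e ▸ hc⟩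

end Formula

open Formula

/-! ## The calculus -/

theorem PropFormula.isSentence_inst {θ : ℕ → Formula σ} (hθ : ∀ n, (θ n).IsSentence)
    (A : PropFormula) : (A.inst θ).IsSentence := by
  induction A <;> simp_all [inst]

theorem PropFormula.rename_inst (f : σ.Const → σ.Const) (θ : ℕ → Formula σ) (A : PropFormula) :
    (A.inst θ).rename f = A.inst fun n => (θ n).rename f := by
  induction A <;> simp_all [inst, Formula.rename]

namespace Thm

variable {φ ψ χ : Formula σ}

theorem isSentence (h : Thm φ) : φ.IsSentence := by
  induction h with
  | intuit A θ _ hθ => exact A.isSentence_inst hθ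
  | univ x φ c h | exist x φ c h => simp [h, h.isSentence_subst]
  | all_ex x φ ψ hφ hψ => simp [hφ, hψ, hφ.imp hψ.freeOnlyIn]
  | all_imp x φ ψ hφ hψ => simp [hφ, hψ, hφ.freeOnlyIn.imp hψ]
  | id_sub x φ c₁ c₂ h => simp [h.isSentence_subst]
  | gen x c _ _ ih => simp [ih.freeOnlyIn_replaceConst]
  | _ => simp_all [iff, neg]

/-- The substitution of `φ`, `ψ`, `χ` for the first three atoms; the later atoms, which do not
occur in the axioms it is applied to, also go to `χ`. -/
def threeAtoms (φ ψ χ : Formula σ) : ℕ → Formula σ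
  | 0 => φ
  | 1 => ψ
  | _ => χ

theorem isSentence_threeAtoms (hφ : φ.IsSentence) (hψ : ψ.IsSentence) (hχ : χ.IsSentence) :
    ∀ n, (threeAtoms φ ψ χ n).IsSentence
  | 0 => hφ
  | 1 => hψ
  | _ + 2 => hχ

theorem k (hφ : φ.IsSentence) (hψ : ψ.IsSentence) : Thm (φ.imp (ψ.imp φ)) :=
  intuit _ _ (IPC.k (.atom 0) (.atom 1)) (isSentence_threeAtoms hφ hψ hψ)

theorem s (hφ : φ.IsSentence) (hψ : ψ.IsSentence) (hχ : χ.IsSentence) :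
    Thm ((φ.imp (ψ.imp χ)).imp ((φ.imp ψ).imp (φ.imp χ))) :=
  intuit _ _ (IPC.s (.atom 0) (.atom 1) (.atom 2)) (isSentence_threeAtoms hφ hψ hχ)

theorem and_left (hφ : φ.IsSentence) (hψ : ψ.IsSentence) : Thm ((φ.and ψ).imp φ) :=
  intuit _ _ (IPC.and_left (.atom 0) (.atom 1)) (isSentence_threeAtoms hφ hψ hψ)

theorem and_right (hφ : φ.IsSentence) (hψ : ψ.IsSentence) : Thm ((φ.and ψ).imp ψ) :=
  intuit _ _ (IPC.and_right (.atom 0) (.atom 1)) (isSentence_threeAtoms hφ hψ hψ)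

theorem and_intro (hφ : φ.IsSentence) (hψ : ψ.IsSentence) : Thm (φ.imp (ψ.imp (φ.and ψ))) :=
  intuit _ _ (IPC.and_intro (.atom 0) (.atom 1)) (isSentence_threeAtoms hφ hψ hψ)

theorem or_left (hφ : φ.IsSentence) (hψ : ψ.IsSentence) : Thm (φ.imp (φ.or ψ)) :=
  intuit _ _ (IPC.or_left (.atom 0) (.atom 1)) (isSentence_threeAtoms hφ hψ hψ)

theorem or_right (hφ : φ.IsSentence) (hψ : ψ.IsSentence) : Thm (ψ.imp (φ.or ψ)) :=
  intuit _ _ (IPC.or_right (.atom 0) (.atom 1)) (isSentence_threeAtoms hφ hψ hψ)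

theorem or_elim (hφ : φ.IsSentence) (hψ : ψ.IsSentence) (hχ : χ.IsSentence) :
    Thm ((φ.imp χ).imp ((ψ.imp χ).imp ((φ.or ψ).imp χ))) :=
  intuit _ _ (IPC.or_elim (.atom 0) (.atom 1) (.atom 2)) (isSentence_threeAtoms hφ hψ hχ)

theorem exfalso (hφ : φ.IsSentence) : Thm (bot.imp φ) :=
  intuit _ _ (IPC.exfalso (.atom 0)) (isSentence_threeAtoms hφ hφ hφ)

theorem isSentence_left (h : Thm (φ.imp ψ)) : φ.IsSentence := (isSentence_imp.1 h.isSentence).1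

theorem isSentence_right (h : Thm (φ.imp ψ)) : ψ.IsSentence := (isSentence_imp.1 h.isSentence).2

theorem imp_of (hψ : ψ.IsSentence) (h : Thm φ) : Thm (ψ.imp φ) := mp (k h.isSentence hψ) h

theorem imp_mp (h : Thm (φ.imp (ψ.imp χ))) (h' : Thm (φ.imp ψ)) : Thm (φ.imp χ) :=
  have hψχ := isSentence_imp.1 h.isSentence_right
  mp (mp (s h.isSentence_left hψχ.1 hψχ.2) h) h'

theorem imp_self (hφ : φ.IsSentence) : Thm (φ.imp φ) :=
  imp_mp (k hφ (isSentence_imp.2 ⟨hφ, hφ⟩)) (k hφ hφ)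

theorem imp_trans (h : Thm (φ.imp ψ)) (h' : Thm (ψ.imp χ)) : Thm (φ.imp χ) :=
  imp_mp (imp_of h.isSentence_left h') h

theorem imp_and (h : Thm (φ.imp ψ)) (h' : Thm (φ.imp χ)) : Thm (φ.imp (ψ.and χ)) :=
  imp_mp (imp_trans h (and_intro h.isSentence_right h'.isSentence_right)) h'

theorem top : Thm (Formula.top : Formula σ) := imp_self rfl

theorem curry (h : Thm ((φ.and ψ).imp χ)) : Thm (φ.imp (ψ.imp χ)) :=
  have hφψ := isSentence_and.1 h.isSentence_left
  imp_trans (and_intro hφψ.1 hφψ.2)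
    (mp (s hφψ.2 h.isSentence_left h.isSentence_right) (imp_of hφψ.2 h))

theorem rename (h : Thm φ) (f : σ.Const → σ.Const) : Thm (φ.rename f) := by
  classical
  induction h generalizing f with
  | intuit A θ hA hθ =>
    rw [A.rename_inst]
    exact intuit A _ hA fun n => (hθ n).rename
  | box_and φ ψ hφ hψ => exact box_and _ _ hφ.rename hψ.rename
  | box_top => exact box_top
  | dia_or φ ψ hφ hψ => exact dia_or _ _ hφ.rename hψ.rename
  | dia_bot => exact dia_bot
  | fs1 φ ψ hφ hψ => exact fs1 _ _ hφ.rename hψ.rename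
  | fs2 φ ψ hφ hψ => exact fs2 _ _ hφ.rename hψ.rename
  | univ x φ c hφ =>
    simp only [Formula.rename, rename_subst]
    exact univ x _ _ hφ.rename
  | exist x φ c hφ =>
    simp only [Formula.rename, rename_subst]
    exact exist x _ _ hφ.rename
  | all_ex x φ ψ hφ hψ => exact all_ex x _ _ hφ.rename hψ.rename
  | all_imp x φ ψ hφ hψ => exact all_imp x _ _ hφ.rename hψ.rename
  | id_refl c => exact id_refl _
  | id_sub x φ c₁ c₂ hφ hm =>
    simp only [Formula.rename, rename_subst]
    exact id_sub x _ _ _ hφ.rename hm.rename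
  | mp _ _ h₁ h₂ => exact mp (h₁ f) (h₂ f)
  | @gen x c φ hs _ ih =>
    -- `f` need not be injective, so `c` is sent to a fresh constant instead of `f c`.
    have := σ.infinite_const
    obtain ⟨c', hc'⟩ := ((finite_hasConst φ).image f).exists_notMem
    have hne : ∀ d, φ.HasConst d → d ≠ c → f d ≠ c' := fun d hd _ e => hc' ⟨d, hd, e⟩
    simp only [Formula.rename]
    rw [← replaceConst_rename_update hne]
    exact gen x c' (hs.rename_update hne) (ih _)
  | reg_box _ ih => exact reg_box (ih f)
  | reg_dia _ ih => exact reg_dia (ih f)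

theorem imp_all {x : ℕ} {c : σ.Const} (hφ : ¬ φ.HasConst c) (hψ : ¬ ψ.HasConst c)
    (hψx : ψ.FreeOnlyIn x) (h : Thm (φ.imp (ψ.subst x c))) : Thm (φ.imp (all x ψ)) := by
  have hc : ¬ (φ.imp ψ).HasConst c := fun h => h.elim hφ hψ
  have hsubst : Thm ((φ.imp ψ).subst x c) := by
    simpa only [subst, h.isSentence_left.subst_eq] using h
  refine mp (all_imp x φ ψ h.isSentence_left hψx) ?_
  simpa only [replaceConst_subst hc] using gen x c (substitutable_subst hc) hsubst

end Thm

section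

variable {L L' : List (Formula σ)} {φ : Formula σ}

theorem isSentence_conj : (conj L).IsSentence ↔ ∀ γ ∈ L, γ.IsSentence := by
  induction L <;> simp_all [conj]

theorem hasConst_conj {c : σ.Const} : (conj L).HasConst c ↔ ∃ γ ∈ L, γ.HasConst c := by
  induction L <;> simp_all [conj, top, neg, HasConst]

theorem rename_conj (f : σ.Const → σ.Const) (L : List (Formula σ)) :
    (conj L).rename f = conj (L.map (Formula.rename f)) := by
  induction L with
  | nil => rfl
  | cons φ L ih => simp [conj, Formula.rename, ih]

theorem Thm.conj_imp (hL : (conj L).IsSentence) (hφ : φ ∈ L) : Thm ((conj L).imp φ) := by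
  induction L with
  | nil => simp at hφ
  | cons ψ L ih =>
    have hψL := isSentence_and.1 hL
    rcases List.mem_cons.1 hφ with rfl | h
    · exact .and_left hψL.1 hψL.2
    · exact (Thm.and_right hψL.1 hψL.2).imp_trans (ih hψL.2 h)

theorem Thm.imp_conj (hφ : φ.IsSentence) (h : ∀ γ ∈ L, Thm (φ.imp γ)) :
    Thm (φ.imp (conj L)) := by
  induction L with
  | nil => exact .imp_of hφ .top
  | cons ψ L ih =>
    simp only [List.mem_cons, forall_eq_or_imp] at h
    exact h.1.imp_and (ih h.2)

theorem Thm.conj_imp_conj (hL : (conj L).IsSentence) (h : L' ⊆ L) :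
    Thm ((conj L).imp (conj L')) :=
  .imp_conj hL fun _ hγ => .conj_imp hL (h hγ)

end

namespace Proves

variable {Γ Γ' : Set (Formula σ)} {φ ψ χ : Formula σ}

theorem isSentence (h : Proves Γ φ) : φ.IsSentence := by
  obtain ⟨L, -, h⟩ := h
  exact h.isSentence_right

theorem isSentence_left (h : Proves Γ (φ.imp ψ)) : φ.IsSentence :=
  (isSentence_imp.1 h.isSentence).1

theorem of_thm (h : Thm φ) : Proves Γ φ := ⟨[], by simp, Thm.imp_of rfl h⟩

theorem of_mem (hφ : φ.IsSentence) (h : φ ∈ Γ) : Proves Γ φ :=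
  ⟨[φ], by simpa using h, Thm.and_left hφ rfl⟩

theorem mono (h : Γ ⊆ Γ') (hφ : Proves Γ φ) : Proves Γ' φ := by
  obtain ⟨L, hL, hφ⟩ := hφ
  exact ⟨L, fun γ hγ => h (hL γ hγ), hφ⟩

theorem mp (h : Proves Γ (φ.imp ψ)) (h' : Proves Γ φ) : Proves Γ ψ := by
  obtain ⟨L, hL, h⟩ := h
  obtain ⟨L', hL', h'⟩ := h'
  have hLL' : (conj (L ++ L')).IsSentence := by
    simpa only [isSentence_conj, List.forall_mem_append] using
      And.intro (isSentence_conj.1 h.isSentence_left) (isSentence_conj.1 h'.isSentence_left)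
  refine ⟨L ++ L', List.forall_mem_append.2 ⟨hL, hL'⟩, Thm.imp_mp (ψ := φ) ?_ ?_⟩
  · exact (Thm.conj_imp_conj hLL' (List.subset_append_left L L')).imp_trans h
  · exact (Thm.conj_imp_conj hLL' (List.subset_append_right L L')).imp_trans h'

theorem mp_thm (h : Proves Γ φ) (h' : Thm (φ.imp ψ)) : Proves Γ ψ := (of_thm h').mp h

theorem thm (h : Proves ∅ φ) : Thm φ := by
  obtain ⟨L, hL, h⟩ := h
  obtain rfl : L = [] := List.eq_nil_iff_forall_not_mem.2 fun γ hγ => hL γ hγ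
  exact h.mp Thm.top

theorem exists_conj {Ξ : Set (Formula σ)} (h : Proves (Γ ∪ Ξ) φ) :
    ∃ L : List (Formula σ), (∀ γ ∈ L, γ ∈ Ξ) ∧ Proves Γ ((conj L).imp φ) := by
  classical
  obtain ⟨L, hL, h⟩ := h
  have hsent := isSentence_conj.1 h.isSentence_left
  have hin : (conj (L.filter (· ∈ Ξ))).IsSentence :=
    isSentence_conj.2 fun γ hγ => hsent γ (List.mem_filter.1 hγ).1
  have hout : (conj (L.filter (· ∉ Ξ))).IsSentence :=
    isSentence_conj.2 fun γ hγ => hsent γ (List.mem_filter.1 hγ).1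
  refine ⟨L.filter (· ∈ Ξ), fun γ hγ => by simpa using (List.mem_filter.1 hγ).2,
    L.filter (· ∉ Ξ), fun γ hγ => ?_, ?_⟩
  · obtain ⟨hγL, hγΞ⟩ := List.mem_filter.1 hγ
    exact (hL γ hγL).resolve_right (by simpa using hγΞ)
  · refine (Thm.imp_trans (Thm.imp_conj (isSentence_and.2 ⟨hout, hin⟩) fun γ hγ => ?_) h).curry
    by_cases hγΞ : γ ∈ Ξ
    · exact (Thm.and_right hout hin).imp_trans (.conj_imp hin (by simp [hγ, hγΞ]))
    · exact (Thm.and_left hout hin).imp_trans (.conj_imp hout (by simp [hγ, hγΞ]))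

theorem self (hφ : φ.IsSentence) : Proves (insert φ Γ) φ := of_mem hφ (Set.mem_insert _ _)

theorem weaken (h : Proves Γ φ) : Proves (insert ψ Γ) φ := h.mono (Set.subset_insert _ _)

theorem intro (hφ : φ.IsSentence) (h : Proves (insert φ Γ) ψ) : Proves Γ (φ.imp ψ) := by
  obtain ⟨L, hL, h⟩ := exists_conj (Ξ := {φ}) (by rwa [Set.union_singleton])
  have hφL : Thm (φ.imp (conj L)) := .imp_conj hφ fun γ hγ =>
    (Set.mem_singleton_iff.1 (hL γ hγ)).symm ▸ .imp_self hφ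
  have hLψ := isSentence_imp.1 h.isSentence
  exact ((h.mp_thm (.k h.isSentence hφ)).mp_thm (.s hφ hLψ.1 hLψ.2)).mp (of_thm hφL)

theorem elim (h : Proves Γ (φ.imp ψ)) : Proves (insert φ Γ) ψ :=
  h.weaken.mp (self h.isSentence_left)

theorem and_intro (h : Proves Γ φ) (h' : Proves Γ ψ) : Proves Γ (φ.and ψ) :=
  (h.mp_thm (.and_intro h.isSentence h'.isSentence)).mp h'

theorem and_left (h : Proves Γ (φ.and ψ)) : Proves Γ φ :=
  have hs := isSentence_and.1 h.isSentence
  h.mp_thm (.and_left hs.1 hs.2)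

theorem and_right (h : Proves Γ (φ.and ψ)) : Proves Γ ψ :=
  have hs := isSentence_and.1 h.isSentence
  h.mp_thm (.and_right hs.1 hs.2)

theorem or_left (hψ : ψ.IsSentence) (h : Proves Γ φ) : Proves Γ (φ.or ψ) :=
  h.mp_thm (.or_left h.isSentence hψ)

theorem or_right (hφ : φ.IsSentence) (h : Proves Γ ψ) : Proves Γ (φ.or ψ) :=
  h.mp_thm (.or_right hφ h.isSentence)

theorem or_imp (h : Proves Γ (φ.imp χ)) (h' : Proves Γ (ψ.imp χ)) : Proves Γ ((φ.or ψ).imp χ) :=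
  have hs := isSentence_imp.1 h.isSentence
  (h.mp_thm (.or_elim hs.1 h'.isSentence_left hs.2)).mp h'

theorem or_elim (h : Proves Γ (φ.or ψ)) (hφ : Proves (insert φ Γ) χ)
    (hψ : Proves (insert ψ Γ) χ) : Proves Γ χ :=
  have hs := isSentence_or.1 h.isSentence
  (or_imp (hφ.intro hs.1) (hψ.intro hs.2)).mp h

theorem imp_trans (h : Proves Γ (φ.imp ψ)) (h' : Proves Γ (ψ.imp χ)) : Proves Γ (φ.imp χ) :=
  intro h.isSentence_left (h'.weaken.mp h.elim)

theorem box_mono (h : Proves Γ (box φ)) (h' : Thm (φ.imp ψ)) : Proves Γ (box ψ) :=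
  h.mp_thm (.reg_box h')

theorem box_and (h : Proves Γ (box φ)) (h' : Proves Γ (box ψ)) : Proves Γ (box (φ.and ψ)) :=
  (of_thm (.box_and φ ψ h.isSentence h'.isSentence)).and_right.mp (h.and_intro h')

theorem all_intro {x : ℕ} {c : σ.Const} (hΓ : ∀ γ ∈ Γ, ¬ γ.HasConst c) (hφ : ¬ φ.HasConst c)
    (hφx : φ.FreeOnlyIn x) (h : Proves Γ (φ.subst x c)) : Proves Γ (all x φ) := by
  obtain ⟨L, hL, h⟩ := h
  refine ⟨L, hL, .imp_all (fun hc => ?_) hφ hφx h⟩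
  obtain ⟨γ, hγ, hγc⟩ := hasConst_conj.1 hc
  exact hΓ γ (hL γ hγ) hγc

theorem ex_imp {x : ℕ} {c : σ.Const} (hΓ : ∀ γ ∈ Γ, ¬ γ.HasConst c) (hφ : ¬ φ.HasConst c)
    (hφx : φ.FreeOnlyIn x) (hψ : ¬ ψ.HasConst c) (h : Proves Γ ((φ.subst x c).imp ψ)) :
    Proves Γ ((ex x φ).imp ψ) := by
  have hψs := (isSentence_imp.1 h.isSentence).2
  have hall : Proves Γ (all x (φ.imp ψ)) :=
    all_intro hΓ (fun h => h.elim hφ hψ) (hφx.imp hψs.freeOnlyIn) <| by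
      simpa only [subst, hψs.subst_eq] using h
  exact hall.mp_thm (.all_ex x φ ψ hφx hψs)

theorem rename (h : Proves Γ φ) (f : σ.Const → σ.Const) :
    Proves (Formula.rename f '' Γ) (φ.rename f) := by
  obtain ⟨L, hL, h⟩ := h
  refine ⟨L.map (Formula.rename f), ?_, rename_conj f L ▸ h.rename f⟩
  simpa only [List.forall_mem_map] using fun γ hγ => Set.mem_image_of_mem _ (hL γ hγ)

theorem exists_of_iUnion {ι : Type*} [Nonempty ι] {Δ : ι → Set (Formula σ)}
    (hΔ : Directed (· ⊆ ·) Δ) (h : Proves (⋃ k, Δ k) φ) : ∃ k, Proves (Δ k) φ := by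
  classical
  obtain ⟨L, hL, h⟩ := h
  obtain ⟨k, hk⟩ := hΔ.exists_mem_subset_of_finset_subset_biUnion (s := L.toFinset)
    fun γ hγ => hL γ (by simpa using hγ)
  exact ⟨k, L, fun γ hγ => hk (by simpa using hγ), h⟩

end Proves

/-! ### Elimination of constants -/

/-- `θ` is a strongest consequence of `φ` among the formulas without constants from `S`. It plays
the role of `∃ c₁ … ∃ cₙ, φ`, where the `cᵢ` are the constants from `S` that occur in `φ`. -/
structure IsProjection (S : Set σ.Const) (φ θ : Formula σ) : Prop where
  mem : θ ∈ sentences {c | φ.HasConst c ∧ c ∉ S}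
  imp : Thm (φ.imp θ)
  elim : ∀ (Γ : Set (Formula σ)) (ψ : Formula σ), (∀ γ ∈ Γ, ∀ c ∈ S, ¬ γ.HasConst c) →
    (∀ c ∈ S, ¬ ψ.HasConst c) → Proves Γ (φ.imp ψ) → Proves Γ (θ.imp ψ)

namespace IsProjection

variable {S T : Set σ.Const} {φ θ χ : Formula σ}

theorem refl (hφ : φ.IsSentence) : IsProjection ∅ φ φ where
  mem := ⟨hφ, fun _ hc => ⟨hc, Set.notMem_empty _⟩⟩
  imp := .imp_self hφ
  elim _ _ _ _ h := h

theorem trans (h : IsProjection S φ θ) (h' : IsProjection T θ χ) : IsProjection (T ∪ S) φ χ where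
  mem := by
    refine ⟨h'.mem.1, fun c hc => ?_⟩
    obtain ⟨hθc, hcT⟩ := h'.mem.2 c hc
    obtain ⟨hφc, hcS⟩ := h.mem.2 c hθc
    exact ⟨hφc, fun hcTS => hcTS.elim hcT hcS⟩
  imp := h.imp.imp_trans h'.imp
  elim Γ ψ hΓ hψ hφψ :=
    h'.elim Γ ψ (fun γ hγ c hc => hΓ γ hγ c (.inl hc)) (fun c hc => hψ c (.inl hc)) <|
      h.elim Γ ψ (fun γ hγ c hc => hΓ γ hγ c (.inr hc)) (fun c hc => hψ c (.inr hc)) hφψ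

theorem of_inter (h : IsProjection (S ∩ {c | φ.HasConst c}) φ θ) : IsProjection S φ θ where
  mem := by
    refine ⟨h.mem.1, fun c hc => ?_⟩
    obtain ⟨hφc, hcS⟩ := h.mem.2 c hc
    exact ⟨hφc, fun hS => hcS ⟨hS, hφc⟩⟩
  imp := h.imp
  elim Γ ψ hΓ hψ := h.elim Γ ψ (fun γ hγ c hc => hΓ γ hγ c hc.1) fun c hc => hψ c hc.1

end IsProjection

variable {φ : Formula σ}

theorem exists_isProjection_singleton (c : σ.Const) (hφ : φ.IsSentence) :
    ∃ θ, IsProjection {c} φ θ := by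
  obtain ⟨y, hy⟩ := Infinite.exists_notMem_finset φ.vars
  have hsubst : (φ.replaceConst c y).subst y c = φ := subst_replaceConst hy
  have hfree : (φ.replaceConst c y).FreeOnlyIn y := hφ.freeOnlyIn_replaceConst
  refine ⟨ex y (φ.replaceConst c y), ⟨⟨isSentence_ex.2 hfree, fun d hd => hd.of_replaceConst⟩,
    ?_, fun Γ ψ hΓ hψ h => ?_⟩⟩
  · simpa only [hsubst] using Thm.exist y _ c hfree
  · exact .ex_imp (fun γ hγ => hΓ γ hγ c rfl) (fun h => h.of_replaceConst.2 rfl) hfree (hψ c rfl)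
      (by rwa [hsubst])

theorem exists_isProjection_of_finite {F : Set σ.Const} (hF : F.Finite) (hφ : φ.IsSentence) :
    ∃ θ, IsProjection F φ θ := by
  induction F, hF using Set.Finite.induction_on with
  | empty => exact ⟨φ, .refl hφ⟩
  | @insert c F _ _ ih =>
    obtain ⟨θ, hθ⟩ := ih
    obtain ⟨χ, hχ⟩ := exists_isProjection_singleton c hθ.mem.1
    exact ⟨χ, hθ.trans hχ⟩

theorem exists_isProjection (S : Set σ.Const) (hφ : φ.IsSentence) : ∃ θ, IsProjection S φ θ :=
  (exists_isProjection_of_finite ((finite_hasConst φ).inter_of_right S) hφ).imp fun _ => .of_inter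

/-! ## Chains of theories -/

/-- The chain `Δ 0, …, Δ n` of theories, the `i`-th one in the language with constants `C i`, cannot
be continued from the `i`-th place, with `B` added there, to a canonical modal path whose last
theory omits `N`. The formula `D` carries the information that the `i`-th theory forces upon the
next one. -/
inductive Refutes (C : ℕ → Set σ.Const) (n : ℕ) (N : Set (Formula σ)) (Δ : ℕ → Set (Formula σ)) :
    ℕ → Formula σ → Prop
  | base {B E : Formula σ} : E ∈ N → Proves (Δ n) (B.imp E) → Refutes C n N Δ n B
  | step {i : ℕ} {B D : Formula σ} : D ∈ sentences (C i) → Refutes C n N Δ (i + 1) D →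
      Proves (Δ i) (B.imp (box D)) → Refutes C n N Δ i B

/-- Any two members of `N` provably imply a common third one. -/
def ImpDirected (N : Set (Formula σ)) : Prop :=
  ∀ E ∈ N, ∀ E' ∈ N, ∃ E'' ∈ N, Thm (E.imp E'') ∧ Thm (E'.imp E'')

theorem impDirected_singleton {φ : Formula σ} (hφ : φ.IsSentence) : ImpDirected {φ} := by
  rintro E rfl E' rfl
  exact ⟨E', rfl, .imp_self hφ, .imp_self hφ⟩

/-- The chain `Δ` with the formula `φ` added to its `j`-th theory. -/
def addAt (Δ : ℕ → Set (Formula σ)) (j : ℕ) (φ : Formula σ) : ℕ → Set (Formula σ) :=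
  Function.update Δ j (insert φ (Δ j))

section addAt

variable {Δ Δ' : ℕ → Set (Formula σ)} {i j : ℕ} {φ ψ : Formula σ}

theorem addAt_self (Δ : ℕ → Set (Formula σ)) (j : ℕ) (φ : Formula σ) :
    addAt Δ j φ j = insert φ (Δ j) := Function.update_self ..

theorem addAt_of_ne (h : i ≠ j) : addAt Δ j φ i = Δ i := Function.update_of_ne h ..

theorem mem_addAt : ψ ∈ addAt Δ j φ i ↔ (i = j ∧ ψ = φ) ∨ ψ ∈ Δ i := by
  rcases eq_or_ne i j with rfl | h
  · simp [addAt_self]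
  · simp [addAt_of_ne h, h]

theorem le_addAt (Δ : ℕ → Set (Formula σ)) (j : ℕ) (φ : Formula σ) : Δ ≤ addAt Δ j φ :=
  fun _ _ hψ => mem_addAt.2 (.inr hψ)

theorem addAt_le (h : Δ ≤ Δ') (hφ : φ ∈ Δ' j) : addAt Δ j φ ≤ Δ' := by
  intro i ψ hψ
  rcases mem_addAt.1 hψ with ⟨rfl, rfl⟩ | hψ
  · exact hφ
  · exact h i hψ

theorem addAt_mono (h : Δ ≤ Δ') : addAt Δ j φ ≤ addAt Δ' j φ :=
  addAt_le (h.trans (le_addAt _ _ _)) (mem_addAt.2 (.inl ⟨rfl, rfl⟩))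

end addAt

/-- The constants of the languages before the `j`-th one. -/
def constsBelow (C : ℕ → Set σ.Const) (j : ℕ) : Set σ.Const := ⋃ i < j, C i

theorem subset_constsBelow (C : ℕ → Set σ.Const) (i : ℕ) : C i ⊆ constsBelow C (i + 1) :=
  Set.subset_biUnion_of_mem (u := C) (Set.mem_Iio.2 i.lt_succ_self)

namespace Refutes

variable {C : ℕ → Set σ.Const} {n : ℕ} {N : Set (Formula σ)} {Δ Δ' Δ'' : ℕ → Set (Formula σ)}
  {i j : ℕ} {B B' φ ψ : Formula σ}

theorem isSentence (h : Refutes C n N Δ i B) : B.IsSentence := by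
  cases h with
  | base _ h | step _ _ h => exact h.isSentence_left

theorem le (h : Refutes C n N Δ i B) : i ≤ n := by
  induction h with
  | base => exact le_rfl
  | step _ _ _ ih => exact (Nat.le_succ _).trans ih

theorem exists_of_lt (h : Refutes C n N Δ i B) (hi : i < n) :
    ∃ D ∈ sentences (C i), Refutes C n N Δ (i + 1) D ∧ Proves (Δ i) (B.imp (box D)) := by
  cases h with
  | base => exact absurd hi (lt_irrefl _)
  | step hD hR hB => exact ⟨_, hD, hR, hB⟩

theorem exists_of_eq (h : Refutes C n N Δ n B) : ∃ E ∈ N, Proves (Δ n) (B.imp E) := by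
  cases h with
  | base hE hB => exact ⟨_, hE, hB⟩
  | step _ hR _ => exact absurd hR.le n.not_succ_le_self

theorem of_imp (h : Refutes C n N Δ i B) (h' : Proves (Δ i) (B'.imp B)) :
    Refutes C n N Δ i B' := by
  cases h with
  | base hE hB => exact base hE (h'.imp_trans hB)
  | step hD hR hB => exact step hD hR (h'.imp_trans hB)

theorem or (hN : ImpDirected N) (h : Refutes C n N Δ i B) (h' : Refutes C n N Δ i B') :
    Refutes C n N Δ i (B.or B') := by
  induction h generalizing B' with
  | @base B E hE hB =>
    obtain ⟨E', hE', hB'⟩ := h'.exists_of_eq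
    obtain ⟨E'', hE'', hEE'', hE'E''⟩ := hN E hE E' hE'
    exact base hE'' (.or_imp (hB.imp_trans (.of_thm hEE'')) (hB'.imp_trans (.of_thm hE'E'')))
  | @step i B D hD hR hB ih =>
    obtain ⟨D', hD', hR', hB'⟩ := h'.exists_of_lt hR.le
    exact step (or_mem_sentences.2 ⟨hD, hD'⟩) (ih hR') <| .or_imp
      (hB.imp_trans (.of_thm (.reg_box (.or_left hD.1 hD'.1))))
      (hB'.imp_trans (.of_thm (.reg_box (.or_right hD.1 hD'.1))))

theorem top_zero (h : Refutes C n N Δ i top) : Refutes C n N Δ 0 top := by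
  induction i with
  | zero => exact h
  | succ i ih => exact ih (step top_mem_sentences h (.of_thm (.imp_of rfl .box_top)))

theorem mono (hΔ : Δ ≤ Δ') (h : Refutes C n N Δ i B) : Refutes C n N Δ' i B := by
  induction h with
  | base hE hB => exact base hE (hB.mono (hΔ _))
  | step hD _ hB ih => exact step hD ih (hB.mono (hΔ _))

theorem congr (hΔ : ∀ m, i ≤ m → Δ m = Δ' m) (h : Refutes C n N Δ i B) :
    Refutes C n N Δ' i B := by
  induction h with
  | base hE hB => exact base hE (hΔ _ le_rfl ▸ hB)
  | step hD _ hB ih =>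
    exact step hD (ih fun m hm => hΔ m (Nat.le_of_succ_le hm)) (hΔ _ le_rfl ▸ hB)

theorem exists_of_iUnion {Δ : ℕ → ℕ → Set (Formula σ)} (hΔ : Monotone Δ)
    (h : Refutes C n N (fun i => ⋃ k, Δ k i) i B) : ∃ k, Refutes C n N (Δ k) i B := by
  have hdir (m : ℕ) : Directed (· ⊆ ·) fun k => Δ k m :=
    Monotone.directed_le fun _ _ hkl => hΔ hkl m
  induction h with
  | base hE hB =>
    obtain ⟨k, hk⟩ := hB.exists_of_iUnion (hdir n)
    exact ⟨k, base hE hk⟩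
  | @step i B D hD _ hB ih =>
    obtain ⟨k, hk⟩ := hB.exists_of_iUnion (hdir i)
    obtain ⟨l, hl⟩ := ih
    exact ⟨max k l, step hD (hl.mono (hΔ (le_max_right k l)))
      (hk.mono (hΔ (le_max_left k l) i))⟩

theorem projection {S : Set σ.Const} (hΔ : ∀ j, ∀ γ ∈ Δ j, ∀ c ∈ S, ¬ γ.HasConst c)
    (hN : ∀ E ∈ N, ∀ c ∈ S, ¬ E.HasConst c) (h : Refutes C n N Δ i B)
    (hB' : IsProjection S B B') : Refutes C n N Δ i B' := by
  induction h generalizing B' with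
  | base hE hB => exact base hE (hB'.elim _ _ (hΔ _) (hN _ hE) hB)
  | @step i B D hD _ hB ih =>
    obtain ⟨D', hD'⟩ := exists_isProjection S hD.1
    refine step ⟨hD'.mem.1, fun c hc => hD.2 c (hD'.mem.2 c hc).1⟩ (ih hD')
      (hB'.elim _ _ (hΔ _) (fun c hc h => (hD'.mem.2 c h).2 hc) ?_)
    exact hB.imp_trans (.of_thm (.reg_box hD'.imp))

theorem propagate₂ (hΔ' : ∀ m < j, Δ' m = Δ m) (hΔ'' : ∀ m < j, Δ'' m = Δ m)
    (hj : ∀ B ∈ sentences (constsBelow C j), ∀ B' ∈ sentences (constsBelow C j),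
      Refutes C n N Δ' j B → Refutes C n N Δ'' j B' → Refutes C n N Δ j (B.and B'))
    (h : Refutes C n N Δ' 0 top) (h' : Refutes C n N Δ'' 0 top) : Refutes C n N Δ 0 top := by
  suffices ∀ d i, i + d = j → ∀ B ∈ sentences (constsBelow C i),
      ∀ B' ∈ sentences (constsBelow C i), Refutes C n N Δ' i B → Refutes C n N Δ'' i B' →
      Refutes C n N Δ i (B.and B') from
    (this j 0 j.zero_add top top_mem_sentences top top_mem_sentences h h').of_imp
      (.of_thm (.imp_and (.imp_self rfl) (.imp_self rfl)))
  intro d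
  induction d with
  | zero =>
    rintro i rfl
    exact hj
  | succ d ih =>
    intro i hi B hBs B' hBs' hB hB'
    have hBB' : (B.and B').IsSentence := isSentence_and.2 ⟨hBs.1, hBs'.1⟩
    have hand : Proves (insert (B.and B') (Δ i)) (B.and B') := .self hBB'
    cases hB with
    | base hE h =>
      rw [hΔ' n (by omega)] at h
      exact base hE (.intro hBB' (h.weaken.mp hand.and_left))
    | @step _ _ D hD hR h =>
      obtain ⟨D', hD', hR', h'⟩ := hB'.exists_of_lt hR.le
      rw [hΔ' i (by omega)] at h
      rw [hΔ'' i (by omega)] at h'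
      have hsub := sentences_mono (subset_constsBelow C i)
      exact step (and_mem_sentences.2 ⟨hD, hD'⟩)
        (ih (i + 1) (by omega) D (hsub hD) D' (hsub hD') hR hR')
        (.intro hBB' ((h.weaken.mp hand.and_left).box_and (h'.weaken.mp hand.and_right)))

theorem propagate (hΔ : ∀ m < j, Δ' m = Δ m)
    (hj : ∀ B ∈ sentences (constsBelow C j), Refutes C n N Δ' j B → Refutes C n N Δ j B)
    (h : Refutes C n N Δ' 0 top) : Refutes C n N Δ 0 top :=
  propagate₂ hΔ hΔ (fun _ hBs _ hBs' hB _ =>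
    (hj _ hBs hB).of_imp (.of_thm (.and_left hBs.1 hBs'.1))) h h

theorem of_addAt_self (hφ : φ.IsSentence) (h : Refutes C n N (addAt Δ j φ) j B) :
    Refutes C n N Δ j (B.and φ) := by
  have hBφ : (B.and φ).IsSentence := isSentence_and.2 ⟨h.isSentence, hφ⟩
  have himp (E : Formula σ) (hE : Proves (addAt Δ j φ j) (B.imp E)) :
      Proves (Δ j) ((B.and φ).imp E) := by
    rw [addAt_self] at hE
    have hand : Proves (insert (B.and φ) (Δ j)) (B.and φ) := .self hBφ
    exact .intro hBφ (((hE.intro hφ).weaken.mp hand.and_right).mp hand.and_left)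
  cases h with
  | base hE hB => exact base hE (himp _ hB)
  | step hD hR hB => exact step hD (hR.congr fun m hm => addAt_of_ne (by omega)) (himp _ hB)

theorem of_addAt_proves (hφ : Proves (Δ j) φ) (h : Refutes C n N (addAt Δ j φ) 0 top) :
    Refutes C n N Δ 0 top :=
  h.propagate (fun _ hm => addAt_of_ne hm.ne) fun _ hB hR =>
    (hR.of_addAt_self hφ.isSentence).of_imp (.intro hB.1 ((Proves.self hB.1).and_intro hφ.weaken))

theorem of_addAt_or (hN : ImpDirected N) (hor : Proves (Δ j) (φ.or ψ))
    (h : Refutes C n N (addAt Δ j φ) 0 top) (h' : Refutes C n N (addAt Δ j ψ) 0 top) :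
    Refutes C n N Δ 0 top := by
  have hφψ := isSentence_or.1 hor.isSentence
  refine propagate₂ (fun _ hm => addAt_of_ne hm.ne) (fun _ hm => addAt_of_ne hm.ne)
    (fun B hBs B' hBs' hB hB' => ?_) h h'
  have hBB' : (B.and B').IsSentence := isSentence_and.2 ⟨hBs.1, hBs'.1⟩
  have hand : Proves (insert (B.and B') (Δ j)) (B.and B') := .self hBB'
  refine ((hB.of_addAt_self hφψ.1).or hN (hB'.of_addAt_self hφψ.2)).of_imp
    (.intro hBB' (hor.weaken.or_elim ?_ ?_))
  · exact .or_left (isSentence_and.2 ⟨hBs'.1, hφψ.2⟩) (hand.and_left.weaken.and_intro (.self hφψ.1))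
  · exact .or_right (isSentence_and.2 ⟨hBs.1, hφψ.1⟩)
      (hand.and_right.weaken.and_intro (.self hφψ.2))

theorem of_addAt_box (hφ : φ ∈ sentences (C j)) (hbox : Proves (Δ j) (box φ))
    (h : Refutes C n N (addAt Δ (j + 1) φ) 0 top) : Refutes C n N Δ 0 top := by
  refine h.propagate (j := j) (fun m hm => addAt_of_ne (by omega)) fun B hB hR => ?_
  cases hR with
  | base hE h =>
    rw [addAt_of_ne n.lt_succ_self.ne] at h
    exact base hE h
  | @step _ _ D hD hR h =>
    rw [addAt_of_ne j.lt_succ_self.ne] at h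
    exact step (and_mem_sentences.2 ⟨hD, hφ⟩) (hR.of_addAt_self hφ.1)
      (.intro hB.1 (h.elim.box_and hbox.weaken))

theorem of_addAt_dia (hj : j < n) (hφ : φ ∈ sentences (C j)) (hmem : Proves (Δ (j + 1)) φ)
    (h : Refutes C n N (addAt Δ j (dia φ)) 0 top) : Refutes C n N Δ 0 top := by
  refine h.propagate (fun _ hm => addAt_of_ne hm.ne) fun B hB hR => ?_
  obtain ⟨D, hD, hR, h⟩ := hR.exists_of_lt hj
  have hR : Refutes C n N Δ (j + 1) D := hR.congr fun m hm => addAt_of_ne (by omega)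
  have hφD := imp_mem_sentences.2 ⟨hφ, hD⟩
  have hdia : (dia φ).IsSentence := hφ.1
  rw [addAt_self] at h
  -- The axiom `(◇φ → □D) → □(φ → D)` moves the added `◇φ` one place further, as `φ`.
  refine step hφD (hR.of_imp (.intro hφD.1 ((Proves.self hφD.1).mp hmem.weaken))) ?_
  refine .intro hB.1 (.mp_thm (.intro hdia ?_) (.fs1 φ D hφ.1 hD.1))
  rw [Set.insert_comm]
  exact h.elim

theorem of_addAt_subst {x : ℕ} {c : σ.Const} (hex : ex x φ ∈ Δ j)
    (hΔ : ∀ i, ∀ γ ∈ Δ i, ¬ γ.HasConst c) (hN : ∀ E ∈ N, ¬ E.HasConst c)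
    (hφ : φ.FreeOnlyIn x) (hc : c ∉ constsBelow C j)
    (h : Refutes C n N (addAt Δ j (φ.subst x c)) 0 top) : Refutes C n N Δ 0 top := by
  refine h.propagate (fun _ hm => addAt_of_ne hm.ne) fun B hB hR => ?_
  have hφc : (φ.subst x c).IsSentence := hφ.isSentence_subst
  have hR := hR.of_addAt_self hφc
  obtain ⟨θ, hθ⟩ := exists_isProjection_singleton c hR.isSentence
  have hRθ : Refutes C n N Δ j θ :=
    hR.projection (by simpa using hΔ) (by simpa using hN) hθ
  have hBc : ¬ B.HasConst c := fun h => hc (hB.2 c h)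
  have hsubst : Proves (insert B (Δ j)) ((φ.subst x c).imp θ) :=
    .intro hφc <| ((Proves.self hB.1).weaken.and_intro (.self hφc)).mp_thm hθ.imp
  have hBex : Proves (insert B (Δ j)) ((ex x φ).imp θ) :=
    .ex_imp (Set.forall_mem_insert.2 ⟨hBc, hΔ j⟩) (hΔ j (ex x φ) hex) hφ
      (fun h => (hθ.mem.2 c h).2 rfl) hsubst
  exact hRθ.of_imp (.intro hB.1 (hBex.mp (.of_mem (isSentence_ex.2 hφ) (.inr hex))))

end Refutes

/-! ## Prime theories -/

/-- The sets of sentences with constants from `S` that are the truth sets of the worlds of the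
canonical model with the constants from `S` as domain: deductively closed, consistent, prime and
with witnesses for existential sentences. -/
structure PrimeTheory (S : Set σ.Const) (T : Set (Formula σ)) : Prop where
  sub : T ⊆ sentences S
  closed : ∀ φ ∈ sentences S, Proves T φ → φ ∈ T
  bot_notMem : bot ∉ T
  prime : ∀ φ ψ, φ.or ψ ∈ T → φ ∈ T ∨ ψ ∈ T
  witness : ∀ x φ, ex x φ ∈ T → ∃ c ∈ S, φ.subst x c ∈ T

/-- The canonical modal accessibility relation, from a theory `T` in the language with constants
`S` to a theory `T'`, which may be in a richer language. -/
structure CanonicalStep (S : Set σ.Const) (T T' : Set (Formula σ)) : Prop where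
  box : ∀ φ, box φ ∈ T → φ ∈ T'
  dia : ∀ φ ∈ sentences S, φ ∈ T' → dia φ ∈ T

/-- Paths `Γ 0, …, Γ n` of the canonical modal accessibility relation; the values `Γ i` for `i > n`
are irrelevant. -/
structure PrimeChain (C : ℕ → Set σ.Const) (n : ℕ) (Γ : ℕ → Set (Formula σ)) : Prop where
  theory : ∀ i ≤ n, PrimeTheory (C i) (Γ i)
  step : ∀ i < n, CanonicalStep (C i) (Γ i) (Γ (i + 1))

theorem PrimeChain.mono {C : ℕ → Set σ.Const} {m n : ℕ} {Γ : ℕ → Set (Formula σ)}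
    (h : PrimeChain C n Γ) (hm : m ≤ n) : PrimeChain C m Γ where
  theory i hi := h.theory i (hi.trans hm)
  step i hi := h.step i (hi.trans_le hm)

theorem PrimeChain.snoc {C : ℕ → Set σ.Const} {n : ℕ} {Γ : ℕ → Set (Formula σ)}
    {T : Set (Formula σ)} (h : PrimeChain C n Γ) (hT : PrimeTheory (C (n + 1)) T)
    (hstep : CanonicalStep (C n) (Γ n) T) :
    PrimeChain C (n + 1) (Function.update Γ (n + 1) T) where
  theory i hi := by
    rcases hi.eq_or_lt with rfl | hi
    · rwa [Function.update_self]
    · rw [Function.update_of_ne hi.ne]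
      exact h.theory i (Nat.le_of_lt_succ hi)
  step i hi := by
    rw [Function.update_of_ne hi.ne]
    rcases (Nat.le_of_lt_succ hi).eq_or_lt with rfl | hi
    · rwa [Function.update_self]
    · rw [Function.update_of_ne (by omega)]
      exact h.step i hi

namespace PrimeTheory

variable {S : Set σ.Const} {T : Set (Formula σ)} {φ ψ : Formula σ} {x : ℕ} {c d e : σ.Const}

theorem proves (h : PrimeTheory S T) (hφ : φ ∈ T) : Proves T φ := .of_mem (h.sub hφ).1 hφ

theorem mem_of_thm (h : PrimeTheory S T) (hφ : φ ∈ sentences S) (hp : Thm φ) : φ ∈ T :=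
  h.closed φ hφ (.of_thm hp)

theorem mp (h : PrimeTheory S T) (hφψ : φ.imp ψ ∈ T) (hφ : φ ∈ T) : ψ ∈ T :=
  h.closed ψ (imp_mem_sentences.1 (h.sub hφψ)).2 ((h.proves hφψ).mp (h.proves hφ))

theorem mp_thm (h : PrimeTheory S T) (hφ : φ ∈ T) (hψ : ψ ∈ sentences S) (hp : Thm (φ.imp ψ)) :
    ψ ∈ T :=
  h.closed ψ hψ ((h.proves hφ).mp_thm hp)

theorem and_mem_iff (h : PrimeTheory S T) : φ.and ψ ∈ T ↔ φ ∈ T ∧ ψ ∈ T := by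
  refine ⟨fun hm => ?_, fun ⟨hφ, hψ⟩ => ?_⟩
  · have hs := and_mem_sentences.1 (h.sub hm)
    exact ⟨h.closed φ hs.1 (h.proves hm).and_left, h.closed ψ hs.2 (h.proves hm).and_right⟩
  · exact h.closed _ (and_mem_sentences.2 ⟨h.sub hφ, h.sub hψ⟩)
      ((h.proves hφ).and_intro (h.proves hψ))

theorem or_mem_iff (h : PrimeTheory S T) (hs : φ.or ψ ∈ sentences S) :
    φ.or ψ ∈ T ↔ φ ∈ T ∨ ψ ∈ T := by
  have hφψ := or_mem_sentences.1 hs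
  refine ⟨h.prime φ ψ, ?_⟩
  rintro (hm | hm)
  · exact h.mp_thm hm hs (.or_left hφψ.1.1 hφψ.2.1)
  · exact h.mp_thm hm hs (.or_right hφψ.1.1 hφψ.2.1)

theorem ex_mem_iff (h : PrimeTheory S T) (hs : ex x φ ∈ sentences S) :
    ex x φ ∈ T ↔ ∃ c ∈ S, φ.subst x c ∈ T := by
  refine ⟨h.witness x φ, ?_⟩
  rintro ⟨c, -, hc⟩
  exact h.mp_thm hc hs (.exist x φ c (isSentence_ex.1 hs.1))

theorem conj_mem (h : PrimeTheory S T) {L : List (Formula σ)} (hL : ∀ γ ∈ L, γ ∈ T) :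
    conj L ∈ T := by
  induction L with
  | nil => exact h.mem_of_thm top_mem_sentences .top
  | cons φ L ih =>
    rw [List.forall_mem_cons] at hL
    exact h.and_mem_iff.2 ⟨hL.1, ih hL.2⟩

theorem box_conj_mem (h : PrimeTheory S T) {L : List (Formula σ)}
    (hL : ∀ γ ∈ L, box γ ∈ T) : box (conj L) ∈ T := by
  induction L with
  | nil => exact h.mem_of_thm (box_mem_sentences.2 top_mem_sentences) .box_top
  | cons φ L ih =>
    rw [List.forall_mem_cons] at hL
    have hφ := hL.1
    have hconj := ih hL.2
    exact h.closed _ (box_mem_sentences.2 (and_mem_sentences.2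
      ⟨box_mem_sentences.1 (h.sub hφ), box_mem_sentences.1 (h.sub hconj)⟩))
      ((h.proves hφ).box_and (h.proves hconj))

theorem subst_mem_of_eq_mem (h : PrimeTheory S T) (heq : eq (.const c) (.const d) ∈ T)
    (hφ : φ.FreeOnlyIn x) (hm : φ.ModalFree) (hc : φ.subst x c ∈ T)
    (hd : φ.subst x d ∈ sentences S) : φ.subst x d ∈ T :=
  h.closed _ hd (((h.proves heq).mp_thm (.id_sub x φ c d hφ hm)).mp (h.proves hc))

theorem eq_refl_mem (h : PrimeTheory S T) (hc : c ∈ S) : eq (.const c) (.const c) ∈ T :=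
  h.mem_of_thm (eq_const_mem_sentences.2 ⟨hc, hc⟩) (.id_refl c)

theorem eq_symm_mem (h : PrimeTheory S T) (hcd : eq (.const c) (.const d) ∈ T) :
    eq (.const d) (.const c) ∈ T := by
  have hs := eq_const_mem_sentences.1 (h.sub hcd)
  have hsubst (b : σ.Const) :
      (eq (.var 0) (.const c)).subst 0 b = eq (.const b) (.const c) := rfl
  have := h.subst_mem_of_eq_mem (φ := eq (.var 0) (.const c)) (x := 0) hcd
    (by simp [FreeOnlyIn, freeVars, Term.freeVars]) trivial
  simp only [hsubst] at this
  exact this (h.eq_refl_mem hs.1) (eq_const_mem_sentences.2 hs.symm)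

theorem eq_trans_mem (h : PrimeTheory S T) (hcd : eq (.const c) (.const d) ∈ T)
    (hde : eq (.const d) (.const e) ∈ T) : eq (.const c) (.const e) ∈ T := by
  have hsubst (b : σ.Const) :
      (eq (.const c) (.var 0)).subst 0 b = eq (.const c) (.const b) := rfl
  have := h.subst_mem_of_eq_mem (φ := eq (.const c) (.var 0)) (x := 0) hde
    (by simp [FreeOnlyIn, freeVars, Term.freeVars]) trivial
  simp only [hsubst] at this
  exact this hcd (eq_const_mem_sentences.2
    ⟨(eq_const_mem_sentences.1 (h.sub hcd)).1, (eq_const_mem_sentences.1 (h.sub hde)).2⟩)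

theorem rel_update_mem (h : PrimeTheory S T) {P : σ.Pred} {a : Fin (σ.arity P) → σ.Const}
    {i : Fin (σ.arity P)} (hd : eq (.const (a i)) (.const d) ∈ T)
    (ha : (rel P fun j => .const (a j)) ∈ T) :
    (rel P fun j => .const (Function.update a i d j)) ∈ T := by
  let θ : Formula σ := rel P fun j => if j = i then .var 0 else .const (a j)
  have hsubst (b : σ.Const) : θ.subst 0 b = rel P fun j => .const (Function.update a i b j) := by
    simp only [θ, subst, rel.injEq, heq_eq_eq, true_and]
    funext j
    rcases eq_or_ne j i with rfl | hj
    · simp [Term.subst]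
    · simp [Term.subst, hj]
  have hθ : θ.FreeOnlyIn 0 := by
    simp only [θ, FreeOnlyIn, freeVars, Finset.biUnion_subset]
    intro j _
    split_ifs <;> simp [Term.freeVars]
  rw [← hsubst]
  refine h.subst_mem_of_eq_mem hd hθ trivial ?_ ?_
  · rwa [hsubst, Function.update_eq_self]
  · rw [hsubst, rel_const_mem_sentences]
    intro j
    rcases eq_or_ne j i with rfl | hj
    · simpa using (eq_const_mem_sentences.1 (h.sub hd)).2
    · simpa [hj] using rel_const_mem_sentences.1 (h.sub ha) j

theorem rel_congr_mem (h : PrimeTheory S T) {P : σ.Pred} {a b : Fin (σ.arity P) → σ.Const}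
    (hab : ∀ i, eq (.const (a i)) (.const (b i)) ∈ T) (ha : (rel P fun i => .const (a i)) ∈ T) :
    (rel P fun i => .const (b i)) ∈ T := by
  suffices ∀ F : Finset (Fin (σ.arity P)), (rel P fun i => .const (F.piecewise b a i)) ∈ T by
    simpa only [Finset.piecewise_univ] using this Finset.univ
  intro F
  induction F using Finset.induction_on with
  | empty => simpa only [Finset.piecewise_empty] using ha
  | insert i F hi ih =>
    rw [Finset.piecewise_insert]
    exact h.rel_update_mem (by simpa only [Finset.piecewise_eq_of_notMem _ _ _ hi] using hab i) ih

end PrimeTheory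

/-! ## Lindenbaum's lemma for chains -/

section Lindenbaum

variable {C : ℕ → Set σ.Const} {n : ℕ} {N : Set (Formula σ)} {Δ Γ : ℕ → Set (Formula σ)}

/-- The constants of the `i`-th language that are available as witnesses: those that are not used
in the earlier languages, in `Δ` and in `N`. -/
def freshConsts (C : ℕ → Set σ.Const) (N : Set (Formula σ)) (Δ : ℕ → Set (Formula σ)) (i : ℕ) :
    Set σ.Const :=
  {c | c ∈ C i ∧ c ∉ constsBelow C i ∧ (∀ j, ∀ γ ∈ Δ j, ¬ γ.HasConst c) ∧
    ∀ E ∈ N, ¬ E.HasConst c}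

/-- The chains of theories from which the Lindenbaum construction can start, and which it passes
through. -/
structure Extendible (C : ℕ → Set σ.Const) (n : ℕ) (N : Set (Formula σ))
    (Δ : ℕ → Set (Formula σ)) : Prop where
  sub : ∀ i ≤ n, Δ i ⊆ sentences (C i)
  not_refutes : ¬ Refutes C n N Δ 0 top
  infinite_fresh : ∀ i ≤ n, (freshConsts C N Δ i).Infinite

/-- The chain `Δ` contains `φ` at the place `j`, with a witness if `φ` is existential, unless adding
`φ` there makes the chain refutable. -/
def Settles (C : ℕ → Set σ.Const) (n : ℕ) (N : Set (Formula σ)) (Δ : ℕ → Set (Formula σ)) (j : ℕ)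
    (φ : Formula σ) : Prop :=
  j ≤ n → φ ∈ sentences (C j) → ¬ Refutes C n N (addAt Δ j φ) 0 top →
    φ ∈ Δ j ∧ ∀ x θ, φ = ex x θ → ∃ c ∈ C j, θ.subst x c ∈ Δ j

theorem Settles.mono {j : ℕ} {φ : Formula σ} (hΔ : Δ ≤ Γ) (h : Settles C n N Δ j φ) :
    Settles C n N Γ j φ := by
  intro hj hφ hR
  obtain ⟨hmem, hwit⟩ := h hj hφ fun hR' => hR (hR'.mono (addAt_mono hΔ))
  refine ⟨hΔ j hmem, fun x θ hθ => ?_⟩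
  obtain ⟨c, hc, hcΔ⟩ := hwit x θ hθ
  exact ⟨c, hc, hΔ j hcΔ⟩

namespace Extendible

theorem addAt {j : ℕ} {φ : Formula σ} (h : Extendible C n N Δ) (hφ : φ ∈ sentences (C j))
    (hR : ¬ Refutes C n N (addAt Δ j φ) 0 top) : Extendible C n N (addAt Δ j φ) where
  sub i hi ψ hψ := by
    rcases mem_addAt.1 hψ with ⟨rfl, rfl⟩ | hψ
    · exact hφ
    · exact h.sub i hi hψ
  not_refutes := hR
  infinite_fresh i hi := by
    refine ((h.infinite_fresh i hi).sdiff (finite_hasConst φ)).mono ?_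
    rintro c ⟨⟨hc, hbelow, hΔ, hN⟩, hφc⟩
    refine ⟨hc, hbelow, fun k γ hγ => ?_, hN⟩
    rcases mem_addAt.1 hγ with ⟨-, rfl⟩ | hγ
    · exact hφc
    · exact hΔ k γ hγ

theorem exists_witness {j x : ℕ} {θ : Formula σ} (h : Extendible C n N Δ) (hj : j ≤ n)
    (hex : ex x θ ∈ Δ j) :
    ∃ c ∈ C j, Extendible C n N (FOFS.addAt Δ j (θ.subst x c)) := by
  have hs := h.sub j hj hex
  obtain ⟨c, hc, hbelow, hΔ, hN⟩ := (h.infinite_fresh j hj).nonempty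
  exact ⟨c, hc, h.addAt (subst_mem_sentences (φ := θ) (x := x) hs hc) fun hR =>
    h.not_refutes (hR.of_addAt_subst hex hΔ hN (isSentence_ex.1 hs.1) hbelow)⟩

theorem exists_settles (h : Extendible C n N Δ) (j : ℕ) (φ : Formula σ) :
    ∃ Δ', Extendible C n N Δ' ∧ Δ ≤ Δ' ∧ Settles C n N Δ' j φ := by
  by_cases hadd : j ≤ n ∧ φ ∈ sentences (C j) ∧ ¬ Refutes C n N (FOFS.addAt Δ j φ) 0 top
  · obtain ⟨hj, hφ, hR⟩ := hadd
    have hext := h.addAt hφ hR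
    have hmem : φ ∈ FOFS.addAt Δ j φ j := mem_addAt.2 (.inl ⟨rfl, rfl⟩)
    by_cases hex : ∃ x θ, φ = ex x θ
    · obtain ⟨x, θ, rfl⟩ := hex
      obtain ⟨c, hc, hext'⟩ := hext.exists_witness hj hmem
      refine ⟨_, hext', (le_addAt _ _ _).trans (le_addAt _ _ _), fun _ _ _ =>
        ⟨mem_addAt.2 (.inr hmem), ?_⟩⟩
      rintro _ _ ⟨⟩
      exact ⟨c, hc, mem_addAt.2 (.inl ⟨rfl, rfl⟩)⟩
    · exact ⟨_, hext, le_addAt _ _ _, fun _ _ _ => ⟨hmem, fun x θ hθ => (hex ⟨x, θ, hθ⟩).elim⟩⟩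
  · exact ⟨Δ, h, le_rfl, fun hj hφ hR => (hadd ⟨hj, hφ, hR⟩).elim⟩

end Extendible

/-- The chains of theories that result from the Lindenbaum construction. -/
structure MaximalChain (C : ℕ → Set σ.Const) (n : ℕ) (N : Set (Formula σ))
    (Γ : ℕ → Set (Formula σ)) : Prop where
  sub : ∀ i ≤ n, Γ i ⊆ sentences (C i)
  not_refutes : ¬ Refutes C n N Γ 0 top
  settles : ∀ i φ, Settles C n N Γ i φ

theorem Extendible.exists_maximalChain (h : Extendible C n N Δ) :
    ∃ Γ, Δ ≤ Γ ∧ MaximalChain C n N Γ := by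
  have : Nonempty (ℕ × Formula σ) := ⟨(0, bot)⟩
  obtain ⟨e, he⟩ := exists_surjective_nat (ℕ × Formula σ)
  choose next hext hle hsettles using
    fun (Δ : {Δ // Extendible C n N Δ}) (p : ℕ × Formula σ) => Δ.2.exists_settles p.1 p.2
  let chain : ℕ → {Δ // Extendible C n N Δ} :=
    Nat.rec ⟨Δ, h⟩ fun k Δ' => ⟨next Δ' (e k), hext Δ' (e k)⟩
  have hmono : Monotone fun k => (chain k).1 := monotone_nat_of_le_succ fun k => hle (chain k) (e k)
  have hchain (k : ℕ) : (chain k).1 ≤ fun i => ⋃ k, (chain k).1 i :=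
    fun i => Set.subset_iUnion (fun k => (chain k).1 i) k
  refine ⟨fun i => ⋃ k, (chain k).1 i, hchain 0,
    fun i hi => Set.iUnion_subset fun k => (chain k).2.sub i hi, fun hR => ?_, fun i φ => ?_⟩
  · obtain ⟨k, hk⟩ := Refutes.exists_of_iUnion hmono hR
    exact (chain k).2.not_refutes hk
  · obtain ⟨k, hk⟩ := he (i, φ)
    have hset : Settles C n N (chain (k + 1)).1 (e k).1 (e k).2 := hsettles (chain k) (e k)
    rw [hk] at hset
    exact hset.mono (hchain (k + 1))

namespace MaximalChain

variable {i : ℕ} {φ ψ : Formula σ}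

theorem mem_of_not_refutes (h : MaximalChain C n N Γ) (hi : i ≤ n) (hφ : φ ∈ sentences (C i))
    (hR : ¬ Refutes C n N (addAt Γ i φ) 0 top) : φ ∈ Γ i := (h.settles i φ hi hφ hR).1

theorem mem_of_proves (h : MaximalChain C n N Γ) (hi : i ≤ n) (hφ : φ ∈ sentences (C i))
    (hp : Proves (Γ i) φ) : φ ∈ Γ i :=
  h.mem_of_not_refutes hi hφ fun hR => h.not_refutes (hR.of_addAt_proves hp)

theorem notMem (h : MaximalChain C n N Γ) {E : Formula σ} (hE : E ∈ N) (hEs : E.IsSentence) :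
    E ∉ Γ n := fun hmem =>
  h.not_refutes (Refutes.base hE (.intro isSentence_top (.of_mem hEs (.inr hmem)))).top_zero

theorem canonicalStep (h : MaximalChain C n N Γ) (hC : Monotone C) (hi : i < n) :
    CanonicalStep (C i) (Γ i) (Γ (i + 1)) where
  box φ hbox := by
    have hbox' := h.sub i hi.le hbox
    have hφ := box_mem_sentences.1 hbox'
    exact h.mem_of_not_refutes hi (sentences_mono (hC i.le_succ) hφ) fun hR =>
      h.not_refutes (hR.of_addAt_box hφ (.of_mem hbox'.1 hbox))
  dia φ hφ hmem := h.mem_of_not_refutes hi.le (dia_mem_sentences.2 hφ) fun hR =>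
    h.not_refutes (hR.of_addAt_dia hi hφ (.of_mem hφ.1 hmem))

theorem bot_notMem (h : MaximalChain C n N Γ) (hC : Monotone C) (hNs : ∀ E ∈ N, E.IsSentence)
    (hne : N.Nonempty) (hi : i ≤ n) : bot ∉ Γ i := by
  obtain ⟨E, hE⟩ := hne
  induction hi using Nat.decreasingInduction with
  | self =>
    exact fun hbot => h.not_refutes (Refutes.base hE (.intro isSentence_top
      ((Proves.of_mem isSentence_bot (.inr hbot)).mp_thm (.exfalso (hNs E hE))))).top_zero
  | of_succ i hi ih =>
    exact fun hbot => ih ((h.canonicalStep hC hi).box bot (h.mem_of_proves hi.le bot_mem_sentences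
      ((Proves.of_mem isSentence_bot hbot).mp_thm (.exfalso (isSentence_box.2 isSentence_bot)))))

theorem mem_or_mem (h : MaximalChain C n N Γ) (hN : ImpDirected N) (hi : i ≤ n)
    (hor : φ.or ψ ∈ Γ i) : φ ∈ Γ i ∨ ψ ∈ Γ i := by
  have hs := h.sub i hi hor
  have hφψ := or_mem_sentences.1 hs
  by_contra! hcon
  have hφ := not_not.1 (mt (h.mem_of_not_refutes hi hφψ.1) hcon.1)
  have hψ := not_not.1 (mt (h.mem_of_not_refutes hi hφψ.2) hcon.2)
  exact h.not_refutes (.of_addAt_or hN (.of_mem hs.1 hor) hφ hψ)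

theorem exists_subst_mem (h : MaximalChain C n N Γ) (hi : i ≤ n) {x : ℕ} (hex : ex x φ ∈ Γ i) :
    ∃ c ∈ C i, φ.subst x c ∈ Γ i :=
  (h.settles i (ex x φ) hi (h.sub i hi hex) fun hR =>
    h.not_refutes (hR.mono (addAt_le le_rfl hex))).2 x φ rfl

theorem primeChain (h : MaximalChain C n N Γ) (hC : Monotone C) (hN : ImpDirected N)
    (hNs : ∀ E ∈ N, E.IsSentence) (hne : N.Nonempty) : PrimeChain C n Γ where
  theory i hi :=
    { sub := h.sub i hi
      closed := fun _ => h.mem_of_proves hi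
      bot_notMem := h.bot_notMem hC hNs hne hi
      prime := fun _ _ => h.mem_or_mem hN hi
      witness := fun _ _ => h.exists_subst_mem hi }
  step _ hi := h.canonicalStep hC hi

end MaximalChain

theorem Extendible.exists_primeChain (h : Extendible C n N Δ) (hC : Monotone C)
    (hN : ImpDirected N) (hNs : ∀ E ∈ N, E.IsSentence) (hne : N.Nonempty) :
    ∃ Γ, PrimeChain C n Γ ∧ Δ ≤ Γ ∧ ∀ E ∈ N, E ∉ Γ n := by
  obtain ⟨Γ, hΔ, hΓ⟩ := h.exists_maximalChain
  exact ⟨Γ, hΓ.primeChain hC hN hNs hne, hΔ, fun E hE => hΓ.notMem hE (hNs E hE)⟩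

end Lindenbaum

/-! ## Extending prime theories and paths -/

section SingleTheory

variable {S S' S₁ S₁' : Set σ.Const} {N T T' T₁ Θ Γ : Set (Formula σ)} {φ : Formula σ}

theorem exists_primeTheory (hΘ : Θ ⊆ sentences S)
    (hfresh : {c ∈ S | (∀ γ ∈ Θ, ¬ γ.HasConst c) ∧ ∀ E ∈ N, ¬ E.HasConst c}.Infinite)
    (hN : ImpDirected N) (hNs : ∀ E ∈ N, E.IsSentence) (hne : N.Nonempty)
    (h : ∀ E ∈ N, ¬ Proves Θ E) : ∃ T, PrimeTheory S T ∧ Θ ⊆ T ∧ ∀ E ∈ N, E ∉ T := by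
  have hext : Extendible (fun _ => S) 0 N fun _ => Θ := by
    refine ⟨fun _ _ => hΘ, fun hR => ?_, fun i hi => hfresh.mono ?_⟩
    · obtain ⟨E, hE, hp⟩ := hR.exists_of_eq
      exact h E hE (hp.mp (.of_thm .top))
    · rintro c ⟨hc, hcΘ, hcN⟩
      obtain rfl : i = 0 := Nat.le_zero.1 hi
      exact ⟨hc, by simp [constsBelow], fun _ => hcΘ, hcN⟩
  obtain ⟨Γ, hΓ, hΘΓ, hNΓ⟩ := hext.exists_primeChain monotone_const hN hNs hne
  exact ⟨Γ 0, hΓ.theory 0 le_rfl, hΘΓ 0, hNΓ⟩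

theorem exists_primeTheory_notMem (hS : S ⊆ S') (hinf : (S' \ S).Infinite) (hΓ : Γ ⊆ sentences S)
    (hφ : φ ∈ sentences S) (h : ¬ Proves Γ φ) : ∃ T, PrimeTheory S' T ∧ Γ ⊆ T ∧ φ ∉ T := by
  obtain ⟨T, hT, hΓT, hφT⟩ := exists_primeTheory (N := {φ}) (hΓ.trans (sentences_mono hS))
    (hinf.mono fun c hc => ⟨hc.1, fun γ hγ hγc => hc.2 ((hΓ hγ).2 c hγc),
      forall_eq.2 fun hφc => hc.2 (hφ.2 c hφc)⟩)
    (impDirected_singleton hφ.1) (forall_eq.2 hφ.1) ⟨φ, rfl⟩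
    (forall_eq.2 h)
  exact ⟨T, hT, hΓT, hφT φ rfl⟩

namespace PrimeTheory

theorem dia_bot_notMem (h : PrimeTheory S T) : dia bot ∉ T := fun hdia =>
  h.bot_notMem (h.mp_thm hdia bot_mem_sentences .dia_bot)

theorem dia_mem_or_dia_mem {ψ : Formula σ} (h : PrimeTheory S T) (hφ : φ ∈ sentences S)
    (hψ : ψ ∈ sentences S) : dia (φ.or ψ) ∈ T → dia φ ∈ T ∨ dia ψ ∈ T := fun hdia =>
  h.prime _ _ (h.closed _ (or_mem_sentences.2 ⟨hφ, hψ⟩)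
    ((Proves.of_thm (.dia_or φ ψ hφ.1 hψ.1)).and_left.mp (h.proves hdia)))

theorem impDirected_dia_notMem (h : PrimeTheory S T) :
    ImpDirected {E ∈ sentences S | dia E ∉ T} := by
  rintro E ⟨hE, hET⟩ E' ⟨hE', hET'⟩
  exact ⟨E.or E', ⟨or_mem_sentences.2 ⟨hE, hE'⟩, fun hdia =>
    (h.dia_mem_or_dia_mem hE hE' hdia).elim hET hET'⟩, .or_left hE.1 hE'.1, .or_right hE.1 hE'.1⟩

theorem dia_mem_of_imp {γ B E : Formula σ} (h : PrimeTheory S T) (hE : E ∈ sentences S)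
    (hγ : dia γ ∈ T) (hB : box B ∈ T) (hp : Thm (γ.imp (B.imp E))) : dia E ∈ T := by
  have hdia : Proves T (dia (B.imp E)) := (h.proves hγ).mp_thm (.reg_dia hp)
  exact h.closed _ (dia_mem_sentences.2 hE)
    ((hdia.mp_thm (.fs2 B E (h.sub hB).1 hE.1)).mp (h.proves hB))

theorem exists_canonicalStep (h : PrimeTheory S T) (hS : S ⊆ S') (hΘ : Θ ⊆ sentences S')
    (hfresh : {c ∈ S' | c ∉ S ∧ ∀ γ ∈ Θ, ¬ γ.HasConst c}.Infinite)
    (hcons : ∀ B E, E ∈ sentences S → box B ∈ T → Proves Θ (B.imp E) → dia E ∈ T) :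
    ∃ T', PrimeTheory S' T' ∧ Θ ⊆ T' ∧ CanonicalStep S T T' := by
  have hbox : {φ | box φ ∈ T} ⊆ sentences S := fun φ hφ => box_mem_sentences.1 (h.sub hφ)
  have hfresh' : {c ∈ S' | (∀ γ ∈ Θ ∪ {φ | box φ ∈ T}, ¬ γ.HasConst c) ∧
      ∀ E ∈ {E ∈ sentences S | dia E ∉ T}, ¬ E.HasConst c}.Infinite := by
    refine hfresh.mono ?_
    rintro c ⟨hc, hcS, hcΘ⟩
    exact ⟨hc, fun γ hγ hγc => hγ.elim (hcΘ γ · hγc) fun hγ => hcS ((hbox hγ).2 c hγc),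
      fun E hE hEc => hcS (hE.1.2 c hEc)⟩
  have hcons' : ∀ E ∈ {E ∈ sentences S | dia E ∉ T}, ¬ Proves (Θ ∪ {φ | box φ ∈ T}) E := by
    rintro E ⟨hE, hdia⟩ hp
    obtain ⟨L, hL, hp⟩ := hp.exists_conj
    exact hdia (hcons _ E hE (h.box_conj_mem hL) hp)
  obtain ⟨T', hT', hsub, hN⟩ := exists_primeTheory
    (Set.union_subset hΘ (hbox.trans (sentences_mono hS))) hfresh' h.impDirected_dia_notMem
    (fun E hE => hE.1.1) ⟨bot, bot_mem_sentences, h.dia_bot_notMem⟩ hcons'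
  exact ⟨T', hT', fun φ hφ => hsub (.inl hφ), fun φ hφ => hsub (.inr hφ),
    fun φ hφ hφT' => not_not.1 fun hdia => hN φ ⟨hφ, hdia⟩ hφT'⟩

theorem exists_canonicalStep_of_dia_mem (h : PrimeTheory S T) (hS : S ⊆ S')
    (hinf : (S' \ S).Infinite) (hφ : dia φ ∈ T) :
    ∃ T', PrimeTheory S' T' ∧ φ ∈ T' ∧ CanonicalStep S T T' := by
  have hs : φ ∈ sentences S := dia_mem_sentences.1 (h.sub hφ)
  obtain ⟨T', hT', hφT', hstep⟩ := h.exists_canonicalStep (Θ := {φ}) hS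
    (Set.singleton_subset_iff.2 (sentences_mono hS hs))
    (hinf.mono fun c hc => ⟨hc.1, hc.2, forall_eq.2 fun hφc => hc.2 (hs.2 c hφc)⟩)
    fun B E hE hB hp => by
      rw [← insert_empty_eq] at hp
      exact h.dia_mem_of_imp hE hφ hB (hp.intro hs.1).thm
  exact ⟨T', hT', hφT' rfl, hstep⟩

theorem exists_canonicalStep_of_subset (h₁ : PrimeTheory S₁ T₁) (hstep : CanonicalStep S T T₁)
    (h' : PrimeTheory S' T') (hT : T ⊆ T') (hS : S ⊆ S₁)
    (hS' : S₁ ∩ S' ⊆ S) (hS₁ : S₁ ⊆ S₁') (hS₁' : S' ⊆ S₁') (hinf : (S₁' \ (S₁ ∪ S')).Infinite) :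
    ∃ T₁', PrimeTheory S₁' T₁' ∧ T₁ ⊆ T₁' ∧ CanonicalStep S' T' T₁' := by
  refine h'.exists_canonicalStep hS₁' (h₁.sub.trans (sentences_mono hS₁)) (hinf.mono ?_) ?_
  · exact fun c hc => ⟨hc.1, fun hcS' => hc.2 (.inr hcS'),
      fun γ hγ hγc => hc.2 (.inl ((h₁.sub hγ).2 c hγc))⟩
  rintro B E hE hB ⟨L, hL, hp⟩
  have hL : conj L ∈ T₁ := h₁.conj_mem hL
  obtain ⟨γ, hγ⟩ := exists_isProjection (S₁ \ S) (h₁.sub hL).1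
  have hγS : γ ∈ sentences S := ⟨hγ.mem.1, fun c hc => by
    obtain ⟨hcL, hcS⟩ := hγ.mem.2 c hc
    exact not_not.1 fun hc' => hcS ⟨(h₁.sub hL).2 c hcL, hc'⟩⟩
  have hγ₁ : γ ∈ T₁ := h₁.mp_thm hL (sentences_mono hS hγS) hγ.imp
  have hBE : B.imp E ∈ sentences S' := imp_mem_sentences.2 ⟨box_mem_sentences.1 (h'.sub hB), hE⟩
  exact h'.dia_mem_of_imp hE (hT (hstep.dia γ hγS hγ₁)) hB
    (hγ.elim ∅ _ (by simp) (fun c hc hc' => hc.2 (hS' ⟨hc.1, hBE.2 c hc'⟩)) (.of_thm hp)).thm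

end PrimeTheory

end SingleTheory

/-- The languages with constants `C' i` expand those with constants `C i`, for all `i` at once, and
each of them has infinitely many constants that occur nowhere before. -/
structure Expansion (C C' : ℕ → Set σ.Const) : Prop where
  le : C ≤ C'
  monotone : Monotone C'
  inter_subset : ∀ i j, C j ∩ C' i ⊆ C i
  infinite_fresh : ∀ i, {c ∈ C' i | c ∉ constsBelow C' i ∧ ∀ j, c ∉ C j}.Infinite

/-- The chain `Γ` with empty theories after its `n`-th place. -/
def cutoff (Γ : ℕ → Set (Formula σ)) (n : ℕ) (i : ℕ) : Set (Formula σ) :=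
  {φ | i ≤ n ∧ φ ∈ Γ i}

theorem cutoff_of_le {Γ : ℕ → Set (Formula σ)} {n i : ℕ} (h : i ≤ n) : cutoff Γ n i = Γ i := by
  simp [cutoff, h]

theorem cutoff_of_lt {Γ : ℕ → Set (Formula σ)} {n i : ℕ} (h : n < i) : cutoff Γ n i = ∅ := by
  simp [cutoff, h.not_ge]

namespace PrimeChain

variable {C C' : ℕ → Set σ.Const} {m n : ℕ} {Γ Δ : ℕ → Set (Formula σ)} {N : Set (Formula σ)}
  {φ ψ : Formula σ}

theorem cutoff_subset_sentences (hΓ : PrimeChain C n Γ) (i : ℕ) :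
    cutoff Γ n i ⊆ sentences (C i) :=
  fun _ hφ => (hΓ.theory i hφ.1).sub hφ.2

theorem refutes_top (hΓ : PrimeChain C n Γ) (hC : Expansion C C') (hnm : n ≤ m)
    (hΔ : ∀ i < n, Δ i = Γ i) (hΓΔ : ∀ i ≤ n, Γ i ⊆ Δ i) (hΔs : ∀ i, Δ i ⊆ sentences (C i))
    (hN : ∀ E ∈ N, ∀ i < n, ∀ c ∈ C' i, E.HasConst c → c ∈ C i) (h : Refutes C' m N Δ 0 top)
    {i : ℕ} (hi : i ≤ n) : Refutes C' m N Δ i top := by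
  induction i with
  | zero => exact h
  | succ i ih =>
    obtain ⟨D, hD, hR, hbox⟩ := (ih (by omega)).exists_of_lt (by omega)
    obtain ⟨D', hD'⟩ := exists_isProjection (C' i \ C i) hD.1
    have hD's : D' ∈ sentences (C i) := ⟨hD'.mem.1, fun c hc => by
      obtain ⟨hcD, hcC⟩ := hD'.mem.2 c hc
      exact not_not.1 fun hc' => hcC ⟨hD.2 c hcD, hc'⟩⟩
    have hR' : Refutes C' m N Δ (i + 1) D' := hR.projection
      (fun j γ hγ c hc hγc => hc.2 (hC.inter_subset i j ⟨(hΔs j hγ).2 c hγc, hc.1⟩))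
      (fun E hE c hc hEc => hc.2 (hN E hE i hi c hc.1 hEc)) hD'
    have hbox' : box D' ∈ Γ i := by
      refine (hΓ.theory i (by omega)).closed _ (box_mem_sentences.2 hD's) ?_
      rw [← hΔ i hi]
      exact (hbox.mp (.of_thm .top)).box_mono hD'.imp
    have hmem : D' ∈ Δ (i + 1) := hΓΔ _ hi ((hΓ.step i hi).box D' hbox')
    exact hR'.of_imp (.intro isSentence_top (.of_mem hD'.mem.1 (.inr hmem)))

theorem exists_extension (hΓ : PrimeChain C n Γ) (hC : Expansion C C') (hnm : n ≤ m)
    (hΔ : ∀ i < n, Δ i = Γ i) (hΓΔ : ∀ i ≤ n, Γ i ⊆ Δ i) (hΔs : ∀ i, Δ i ⊆ sentences (C i))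
    (hψ : ψ.IsSentence) (hψC : ∀ i < n, ∀ c ∈ C' i, ψ.HasConst c → c ∈ C i)
    (h : ¬ Refutes C' m {ψ} Δ n top) : ∃ Γ', PrimeChain C' m Γ' ∧ Δ ≤ Γ' ∧ ψ ∉ Γ' m := by
  have hext : Extendible C' m {ψ} Δ := by
    refine ⟨fun i _ => (hΔs i).trans (sentences_mono (hC.le i)), fun hR => h ?_, fun i _ => ?_⟩
    · exact hΓ.refutes_top hC hnm hΔ hΓΔ hΔs (forall_eq.2 hψC) hR le_rfl
    · refine ((hC.infinite_fresh i).sdiff (finite_hasConst ψ)).mono ?_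
      rintro c ⟨⟨hc, hbelow, hcC⟩, hψc⟩
      exact ⟨hc, hbelow, fun j γ hγ hγc => hcC j ((hΔs j hγ).2 c hγc),
        forall_eq.2 hψc⟩
  obtain ⟨Γ', hΓ', hΔΓ', hψΓ'⟩ := hext.exists_primeChain hC.monotone (impDirected_singleton hψ)
    (forall_eq.2 hψ) ⟨ψ, rfl⟩
  exact ⟨Γ', hΓ', hΔΓ', hψΓ' ψ rfl⟩

theorem exists_extension_of_imp_notMem (hΓ : PrimeChain C n Γ) (hC : Expansion C C')
    (hs : φ.imp ψ ∈ sentences (C n)) (h : φ.imp ψ ∉ Γ n) :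
    ∃ Γ', PrimeChain C' n Γ' ∧ (∀ i ≤ n, Γ i ⊆ Γ' i) ∧ φ ∈ Γ' n ∧ ψ ∉ Γ' n := by
  have hφψ := imp_mem_sentences.1 hs
  have hΓΔ (i : ℕ) (hi : i ≤ n) : Γ i ⊆ addAt (cutoff Γ n) n φ i := by
    have := le_addAt (cutoff Γ n) n φ i
    rwa [cutoff_of_le hi] at this
  have hΔs (i : ℕ) : addAt (cutoff Γ n) n φ i ⊆ sentences (C i) := by
    intro γ hγ
    rcases mem_addAt.1 hγ with ⟨rfl, rfl⟩ | hγ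
    · exact hφψ.1
    · exact hΓ.cutoff_subset_sentences i hγ
  have hR : ¬ Refutes C' n {ψ} (addAt (cutoff Γ n) n φ) n top := fun hR => by
    obtain ⟨E, rfl, hp⟩ := hR.exists_of_eq
    rw [addAt_self, cutoff_of_le le_rfl] at hp
    exact h ((hΓ.theory n le_rfl).closed _ hs (.intro hφψ.1.1 (hp.mp (.of_thm .top))))
  obtain ⟨Γ', hΓ', hΔΓ', hψ⟩ := hΓ.exists_extension hC le_rfl
    (fun i hi => by rw [addAt_of_ne hi.ne, cutoff_of_le hi.le]) hΓΔ hΔs hφψ.2.1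
    (fun i _ c hc hψc => hC.inter_subset i n ⟨hφψ.2.2 c hψc, hc⟩) hR
  exact ⟨Γ', hΓ', fun i hi => (hΓΔ i hi).trans (hΔΓ' i), hΔΓ' n (mem_addAt.2 (.inl ⟨rfl, rfl⟩)),
    hψ⟩

theorem exists_extension_of_not_refutes (hΓ : PrimeChain C n Γ) (hC : Expansion C C')
    (hnm : n ≤ m) (hψ : ψ.IsSentence) (hψC : ∀ i < n, ∀ c ∈ C' i, ψ.HasConst c → c ∈ C i)
    (h : ¬ Refutes C' m {ψ} (cutoff Γ n) n top) :
    ∃ Γ', PrimeChain C' m Γ' ∧ (∀ i ≤ n, Γ i ⊆ Γ' i) ∧ ψ ∉ Γ' m := by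
  obtain ⟨Γ', hΓ', hΔΓ', hψ⟩ := hΓ.exists_extension hC hnm (fun i hi => cutoff_of_le hi.le)
    (fun i hi => (cutoff_of_le hi).ge) hΓ.cutoff_subset_sentences hψ hψC h
  exact ⟨Γ', hΓ', fun i hi => (cutoff_of_le hi).ge.trans (hΔΓ' i), hψ⟩

theorem exists_extension_of_all_notMem {x : ℕ} (hΓ : PrimeChain C n Γ) (hC : Expansion C C')
    (hs : all x φ ∈ sentences (C n)) (h : all x φ ∉ Γ n) :
    ∃ Γ', PrimeChain C' n Γ' ∧ (∀ i ≤ n, Γ i ⊆ Γ' i) ∧ ∃ c ∈ C' n, φ.subst x c ∉ Γ' n := by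
  obtain ⟨c, hc, hbelow, hcC⟩ := (hC.infinite_fresh n).nonempty
  have hφ := isSentence_all.1 hs.1
  have hsubst (i : ℕ) (hi : i < n) (d : σ.Const) (hd : d ∈ C' i)
      (hφd : (φ.subst x c).HasConst d) : d ∈ C i := by
    rcases hφd.of_subst with hφd | rfl
    · exact hC.inter_subset i n ⟨hs.2 d hφd, hd⟩
    · exact (hbelow (Set.mem_biUnion hi hd)).elim
  have hR : ¬ Refutes C' n {φ.subst x c} (cutoff Γ n) n top := fun hR => by
    obtain ⟨E, rfl, hp⟩ := hR.exists_of_eq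
    rw [cutoff_of_le le_rfl] at hp
    have hT := hΓ.theory n le_rfl
    exact h (hT.closed _ hs ((hp.mp (.of_thm .top)).all_intro
      (fun γ hγ hγc => hcC n ((hT.sub hγ).2 c hγc)) (fun hφc => hcC n (hs.2 c hφc)) hφ))
  obtain ⟨Γ', hΓ', hΓΓ', hψ⟩ := hΓ.exists_extension_of_not_refutes hC le_rfl
    hφ.isSentence_subst hsubst hR
  exact ⟨Γ', hΓ', hΓΓ', c, hc, hψ⟩

theorem exists_extension_of_box_notMem (hΓ : PrimeChain C n Γ) (hC : Expansion C C')
    (hs : box φ ∈ sentences (C n)) (h : box φ ∉ Γ n) :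
    ∃ Γ', PrimeChain C' (n + 1) Γ' ∧ (∀ i ≤ n, Γ i ⊆ Γ' i) ∧ φ ∉ Γ' (n + 1) := by
  refine hΓ.exists_extension_of_not_refutes hC n.le_succ hs.1
    (fun i _ c hc hφc => hC.inter_subset i n ⟨hs.2 c hφc, hc⟩) fun hR => ?_
  obtain ⟨D, -, hR, hD⟩ := hR.exists_of_lt n.lt_succ_self
  obtain ⟨E, rfl, hE⟩ := hR.exists_of_eq
  rw [cutoff_of_le le_rfl] at hD
  rw [cutoff_of_lt n.lt_succ_self] at hE
  exact h ((hΓ.theory n le_rfl).closed _ hs ((hD.mp (.of_thm .top)).box_mono hE.thm))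

end PrimeChain

/-! ## The canonical model -/

/-- A classification of the constants by a level and a stage, every combination being taken by
infinitely many constants, with an embedding of all constants into those of level and stage `0`.
A world of depth `n` and stage `s` uses the constants of level at most `n` and stage at most `s`:
the constants of level `n + 1` are its spare ones for `M`-successors, those of stage `s + 1` its
spare ones for `≤`-successors. -/
structure Stratification (σ : Signature.{u}) where
  level : σ.Const → ℕ
  stage : σ.Const → ℕ
  infinite_fiber : ∀ i s, {c | level c = i ∧ stage c = s}.Infinite
  emb : σ.Const → σ.Const
  emb_injective : Function.Injective emb
  level_emb : ∀ c, level (emb c) = 0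
  stage_emb : ∀ c, stage (emb c) = 0

theorem nonempty_stratification (σ : Signature.{u}) : Nonempty (Stratification σ) := by
  have := σ.countable_const
  have := σ.infinite_const
  obtain ⟨e⟩ : Nonempty (σ.Const ≃ ℕ × ℕ × ℕ) := nonempty_equiv_of_countable
  obtain ⟨e₀⟩ : Nonempty (σ.Const ≃ ℕ) := nonempty_equiv_of_countable
  refine ⟨⟨fun c => (e c).1, fun c => (e c).2.1, fun i s => ?_, fun c => e.symm (0, 0, e₀ c),
    fun c d h => by simpa using h, fun c => by simp, fun c => by simp⟩⟩
  have hinj : Function.Injective fun k : ℕ => e.symm (i, s, k) := fun a b h => by simpa using h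
  refine (Set.infinite_range_of_injective hinj).mono ?_
  rintro _ ⟨k, rfl⟩
  simp

namespace Stratification

variable (S : Stratification σ)

/-- The constants available to a world of depth `i` and stage `s`. -/
def consts (s i : ℕ) : Set σ.Const := {c | S.level c ≤ i ∧ S.stage c ≤ s}

theorem consts_mono {s s' i i' : ℕ} (hs : s ≤ s') (hi : i ≤ i') :
    S.consts s i ⊆ S.consts s' i' :=
  fun _ hc => ⟨hc.1.trans hi, hc.2.trans hs⟩

theorem emb_mem_consts (c : σ.Const) (s i : ℕ) : S.emb c ∈ S.consts s i :=
  ⟨(S.level_emb c).le.trans (Nat.zero_le _), (S.stage_emb c).le.trans (Nat.zero_le _)⟩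

theorem rename_mem_sentences {φ : Formula σ} (hφ : φ.IsSentence) (s i : ℕ) :
    φ.rename S.emb ∈ sentences (S.consts s i) := by
  refine ⟨hφ.rename, fun c hc => ?_⟩
  obtain ⟨d, -, rfl⟩ := hasConst_rename.1 hc
  exact S.emb_mem_consts d s i

theorem infinite_consts_succ_left_sdiff (s i : ℕ) :
    (S.consts (s + 1) i \ S.consts s i).Infinite :=
  (S.infinite_fiber i (s + 1)).mono fun _ hc =>
    ⟨⟨hc.1.le, hc.2.le⟩, fun hc' => by have := hc.2 ▸ hc'.2; omega⟩

theorem infinite_consts_succ_right_sdiff (s i : ℕ) :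
    (S.consts s (i + 1) \ S.consts s i).Infinite :=
  (S.infinite_fiber (i + 1) s).mono fun _ hc =>
    ⟨⟨hc.1.le, hc.2.le⟩, fun hc' => by have := hc.1 ▸ hc'.1; omega⟩

theorem expansion (s : ℕ) : Expansion (S.consts s) (S.consts (s + 1)) where
  le _ := S.consts_mono s.le_succ le_rfl
  monotone _ _ h := S.consts_mono le_rfl h
  inter_subset _ _ _ hc := ⟨hc.2.1, hc.1.2⟩
  infinite_fresh i := by
    refine (S.infinite_fiber i (s + 1)).mono ?_
    rintro c ⟨hl, hs⟩
    refine ⟨⟨hl.le, hs.le⟩, fun hc => ?_, fun j hc => by have := hs ▸ hc.2; omega⟩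
    obtain ⟨j, hj, hc⟩ := Set.mem_iUnion₂.1 hc
    have := hl ▸ hc.1
    omega

/-- The worlds of the canonical model. A world is a prime theory `th depth` together with the prime
theories `th 0, …, th (depth - 1)` along an `M`-path leading to it; what `th` does beyond `depth`
does not matter. -/
structure World where
  depth : ℕ
  stage : ℕ
  th : ℕ → Set (Formula σ)
  chain : PrimeChain (S.consts stage) depth th

namespace World

variable {S} {w v w' v' : S.World} {φ ψ : Formula σ}

/-- The theory of a world: the last one on its path. -/
def thy (w : S.World) : Set (Formula σ) := w.th w.depth

/-- The domain of a world. -/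
def dom (w : S.World) : Set σ.Const := S.consts w.stage w.depth

theorem primeTheory (w : S.World) : PrimeTheory w.dom w.thy := w.chain.theory _ le_rfl

theorem emb_mem_dom (w : S.World) (c : σ.Const) : S.emb c ∈ w.dom := S.emb_mem_consts c _ _

instance : PartialOrder S.World where
  le w w' := w = w' ∨ (w.depth = w'.depth ∧ w.stage < w'.stage ∧ ∀ i ≤ w.depth, w.th i ⊆ w'.th i)
  le_refl w := .inl rfl
  le_trans w w' w'' := by
    rintro (rfl | ⟨hd, hs, hth⟩) (rfl | ⟨hd', hs', hth'⟩)
    · exact .inl rfl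
    · exact .inr ⟨hd', hs', hth'⟩
    · exact .inr ⟨hd, hs, hth⟩
    · exact .inr ⟨hd.trans hd', hs.trans hs', fun i hi => (hth i hi).trans (hth' i (hd ▸ hi))⟩
  le_antisymm w w' := by
    rintro (rfl | ⟨-, hs, -⟩) (h | ⟨-, hs', -⟩)
    · rfl
    · rfl
    · exact h.symm
    · omega

theorem thy_subset (h : w ≤ w') : w.thy ⊆ w'.thy := by
  rcases h with rfl | ⟨hd, -, hth⟩
  · exact subset_rfl
  · rw [thy, thy, ← hd]
    exact hth _ le_rfl

theorem dom_subset (h : w ≤ w') : w.dom ⊆ w'.dom := by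
  rcases h with rfl | ⟨hd, hs, -⟩
  · exact subset_rfl
  · exact S.consts_mono hs.le hd.le

/-- The modal relation of the canonical model: `v` extends the path of `w` by one theory. -/
def M (w v : S.World) : Prop :=
  v.depth = w.depth + 1 ∧ v.stage = w.stage ∧ ∀ i ≤ w.depth, v.th i = w.th i

theorem M.dom_subset (h : w.M v) : w.dom ⊆ v.dom :=
  S.consts_mono h.2.1.ge (by rw [h.1]; exact Nat.le_succ _)

theorem M.canonicalStep (h : w.M v) : CanonicalStep w.dom w.thy v.thy := by
  have hstep := v.chain.step w.depth (by rw [h.1]; exact Nat.lt_succ_self _)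
  rwa [h.2.1, h.2.2 _ le_rfl, ← h.1] at hstep

/-- The world at depth `m` on the path of `v`. -/
def truncate (v : S.World) (m : ℕ) (hm : m ≤ v.depth) : S.World :=
  ⟨m, v.stage, v.th, v.chain.mono hm⟩

theorem M_truncate {m : ℕ} (hm : v.depth = m + 1) : (v.truncate m (by omega)).M v :=
  ⟨hm, rfl, fun _ _ => rfl⟩

theorem exists_M_of_le (h : w.M v) (hv : v ≤ v') : ∃ w', w ≤ w' ∧ w'.M v' := by
  rcases hv with rfl | ⟨hd, hs, hth⟩
  · exact ⟨w, le_rfl, h⟩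
  have hd' : v'.depth = w.depth + 1 := hd ▸ h.1
  refine ⟨v'.truncate w.depth (by omega), .inr ⟨rfl, h.2.1 ▸ hs, fun i hi => ?_⟩, M_truncate hd'⟩
  rw [← h.2.2 i hi]
  exact hth i (by omega)

theorem exists_M_thy_eq {T : Set (Formula σ)} (hT : PrimeTheory (S.consts w.stage (w.depth + 1)) T)
    (hstep : CanonicalStep w.dom w.thy T) : ∃ v, w.M v ∧ v.thy = T :=
  ⟨⟨w.depth + 1, w.stage, _, w.chain.snoc hT hstep⟩,
    ⟨rfl, rfl, fun _ hi => Function.update_of_ne (by omega) ..⟩, Function.update_self ..⟩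

theorem exists_M_of_dia_mem (h : dia φ ∈ w.thy) : ∃ v, w.M v ∧ φ ∈ v.thy := by
  obtain ⟨T, hT, hφ, hstep⟩ := w.primeTheory.exists_canonicalStep_of_dia_mem
    (S.consts_mono le_rfl (Nat.le_succ _)) (S.infinite_consts_succ_right_sdiff _ _) h
  obtain ⟨v, hv, rfl⟩ := exists_M_thy_eq hT hstep
  exact ⟨v, hv, hφ⟩

theorem exists_le_of_M (hw : w ≤ w') (h : w.M v) : ∃ v', v ≤ v' ∧ w'.M v' := by
  rcases id hw with rfl | ⟨hd, hs, hth⟩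
  · exact ⟨v, le_rfl, h⟩
  obtain ⟨hvd, hvs, hvth⟩ := id h
  have hinter : v.dom ∩ w'.dom ⊆ w.dom := fun c ⟨hc, hc'⟩ => ⟨hd ▸ hc'.1, hvs ▸ hc.2⟩
  have hinf : (S.consts w'.stage (w'.depth + 1) \ (v.dom ∪ w'.dom)).Infinite := by
    refine (S.infinite_fiber (w'.depth + 1) w'.stage).mono ?_
    rintro c ⟨hl, hc⟩
    refine ⟨⟨hl.le, hc.le⟩, ?_⟩
    rintro (⟨-, hcv⟩ | ⟨hcw, -⟩) <;> omega
  obtain ⟨T, hT, hvT, hstep⟩ := v.primeTheory.exists_canonicalStep_of_subset h.canonicalStep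
    w'.primeTheory (thy_subset hw) h.dom_subset hinter
    (S.consts_mono (by omega) (by omega)) (S.consts_mono le_rfl (Nat.le_succ _)) hinf
  obtain ⟨v', hv', rfl⟩ := exists_M_thy_eq hT hstep
  have hd' : v.depth = v'.depth := by rw [hvd, hv'.1, hd]
  refine ⟨v', .inr ⟨hd', by rw [hvs, hv'.2.1]; exact hs, fun i hi => ?_⟩, hv'⟩
  rcases hi.eq_or_lt with rfl | hi
  · change v.thy ⊆ v'.th v.depth
    rw [hd']
    exact hvT
  · rw [hvth i (by omega), hv'.2.2 i (by omega)]
    exact hth i (by omega)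

theorem exists_le_of_imp_notMem (hs : φ.imp ψ ∈ sentences w.dom) (h : φ.imp ψ ∉ w.thy) :
    ∃ w', w ≤ w' ∧ φ ∈ w'.thy ∧ ψ ∉ w'.thy := by
  obtain ⟨Γ, hΓ, hsub, hφ, hψ⟩ := w.chain.exists_extension_of_imp_notMem (S.expansion _) hs h
  exact ⟨⟨w.depth, w.stage + 1, Γ, hΓ⟩, .inr ⟨rfl, Nat.lt_succ_self _, hsub⟩, hφ, hψ⟩

theorem exists_le_of_all_notMem {x : ℕ} (hs : all x φ ∈ sentences w.dom) (h : all x φ ∉ w.thy) :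
    ∃ w', w ≤ w' ∧ ∃ c ∈ w'.dom, φ.subst x c ∉ w'.thy := by
  obtain ⟨Γ, hΓ, hsub, hφ⟩ := w.chain.exists_extension_of_all_notMem (S.expansion _) hs h
  exact ⟨⟨w.depth, w.stage + 1, Γ, hΓ⟩, .inr ⟨rfl, Nat.lt_succ_self _, hsub⟩, hφ⟩

theorem exists_M_of_box_notMem (hs : box φ ∈ sentences w.dom) (h : box φ ∉ w.thy) :
    ∃ w' v, w ≤ w' ∧ w'.M v ∧ φ ∉ v.thy := by
  obtain ⟨Γ, hΓ, hsub, hφ⟩ := w.chain.exists_extension_of_box_notMem (S.expansion _) hs h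
  let v : S.World := ⟨w.depth + 1, w.stage + 1, Γ, hΓ⟩
  exact ⟨v.truncate w.depth (Nat.le_succ _), v, .inr ⟨rfl, Nat.lt_succ_self _, hsub⟩,
    M_truncate rfl, hφ⟩

theorem exists_root {Γ : Set (Formula σ)} (hΓ : Γ ⊆ sentences (S.consts 0 0))
    (hφ : φ ∈ sentences (S.consts 0 0)) (h : ¬ Proves Γ φ) :
    ∃ w : S.World, Γ ⊆ w.thy ∧ φ ∉ w.thy := by
  obtain ⟨T, hT, hΓT, hφT⟩ := exists_primeTheory_notMem (S.consts_mono zero_le_one le_rfl)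
    (S.infinite_consts_succ_left_sdiff 0 0) hΓ hφ h
  have hchain : PrimeChain (S.consts 1) 0 fun _ => T :=
    ⟨fun i hi => by rwa [Nat.le_zero.1 hi], fun i hi => absurd hi (Nat.not_lt_zero i)⟩
  exact ⟨⟨0, 1, _, hchain⟩, hΓT, hφT⟩

theorem imp_mem_iff (hs : φ.imp ψ ∈ sentences w.dom) :
    φ.imp ψ ∈ w.thy ↔ ∀ w', w ≤ w' → φ ∈ w'.thy → ψ ∈ w'.thy := by
  refine ⟨fun h w' hw hφ => w'.primeTheory.mp (thy_subset hw h) hφ, fun h => ?_⟩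
  by_contra hmem
  obtain ⟨w', hw, hφ, hψ⟩ := exists_le_of_imp_notMem hs hmem
  exact hψ (h w' hw hφ)

theorem box_mem_iff (hs : box φ ∈ sentences w.dom) :
    box φ ∈ w.thy ↔ ∀ w' v, w ≤ w' → w'.M v → φ ∈ v.thy := by
  refine ⟨fun h w' v hw hv => hv.canonicalStep.box φ (thy_subset hw h), fun h => ?_⟩
  by_contra hmem
  obtain ⟨w', v, hw, hv, hφ⟩ := exists_M_of_box_notMem hs hmem
  exact hφ (h w' v hw hv)

theorem dia_mem_iff (hs : dia φ ∈ sentences w.dom) :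
    dia φ ∈ w.thy ↔ ∃ v, w.M v ∧ φ ∈ v.thy :=
  ⟨exists_M_of_dia_mem, fun ⟨_, hv, hφ⟩ => hv.canonicalStep.dia φ (dia_mem_sentences.1 hs) hφ⟩

theorem all_mem_iff {x : ℕ} (hs : all x φ ∈ sentences w.dom) :
    all x φ ∈ w.thy ↔ ∀ w', w ≤ w' → ∀ c ∈ w'.dom, φ.subst x c ∈ w'.thy := by
  refine ⟨fun h w' hw c hc => ?_, fun h => ?_⟩
  · exact w'.primeTheory.mp_thm (thy_subset hw h)
      (subst_mem_sentences (sentences_mono (dom_subset hw) hs) hc)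
      (.univ x φ c (isSentence_all.1 hs.1))
  · by_contra hmem
    obtain ⟨w', hw, c, hc, hφ⟩ := exists_le_of_all_notMem hs hmem
    exact hφ (h w' hw c hc)

theorem update_mem_dom {g : ℕ → σ.Const} {x : ℕ} {a : σ.Const} (hg : ∀ y, g y ∈ w.dom)
    (ha : a ∈ w.dom) (y : ℕ) : Function.update g x a y ∈ w.dom := by
  rcases eq_or_ne y x with rfl | hy
  · rwa [Function.update_self]
  · rw [Function.update_of_ne hy]
    exact hg y

end World

/-- The canonical model. Its elements are the constants, and a constant `c` of the given language
denotes `S.emb c`. -/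
def canonicalModel : Model.{u} σ where
  World := S.World
  order := inferInstance
  M := World.M
  fc1 _ _ _ h hv := World.exists_M_of_le h hv
  fc2 _ _ _ hw h := World.exists_le_of_M hw h
  Elem := σ.Const
  D := World.dom
  D_le _ _ h := World.dom_subset h
  D_M _ _ h := h.dom_subset
  E w a b := eq (.const a) (.const b) ∈ w.thy
  E_dom w _ _ h := eq_const_mem_sentences.1 (w.primeTheory.sub h)
  E_refl w _ ha := w.primeTheory.eq_refl_mem ha
  E_symm w _ _ h := w.primeTheory.eq_symm_mem h
  E_trans w _ _ _ h h' := w.primeTheory.eq_trans_mem h h'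
  E_le _ _ _ _ h := fun hm => World.thy_subset h hm
  constI := S.emb
  constI_mem c w := w.emb_mem_dom c
  predI w P := {a | (rel P fun i => .const (a i)) ∈ w.thy}
  predI_dom w _ _ ha := rel_const_mem_sentences.1 (w.primeTheory.sub ha)
  predI_le _ _ _ h := fun _ ha => World.thy_subset h ha
  predI_E w _ _ _ h ha := w.primeTheory.rel_congr_mem h ha

/-- The sentence about the elements of the canonical model that `φ` expresses under the
assignment `g`. -/
def eval (g : ℕ → σ.Const) (φ : Formula σ) : Formula σ := (φ.rename S.emb).inst fun x => some (g x)

variable {S} {g : ℕ → σ.Const}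

theorem eval_mem_sentences {w : S.World} (hg : ∀ x, g x ∈ w.dom) (φ : Formula σ) :
    S.eval g φ ∈ sentences w.dom := by
  refine ⟨Finset.eq_empty_of_forall_notMem fun y hy => ?_, fun c hc => ?_⟩
  · exact Option.some_ne_none _ (mem_freeVars_inst.1 hy).2
  · rcases hc.of_inst with hc | ⟨x, hx⟩
    · obtain ⟨d, -, rfl⟩ := hasConst_rename.1 hc
      exact w.emb_mem_dom d
    · exact Option.some.inj hx ▸ hg x

theorem eval_eq_rename {φ : Formula σ} (hφ : φ.IsSentence) : S.eval g φ = φ.rename S.emb := by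
  have hφ' : (φ.rename S.emb).freeVars = ∅ := hφ.rename
  exact inst_eq_self fun x hx => by simp [hφ'] at hx

theorem subst_inst_update (x : ℕ) (a : σ.Const) (φ : Formula σ) :
    ((φ.rename S.emb).inst (Function.update (fun y => some (g y)) x none)).subst x a =
      S.eval (Function.update g x a) φ := by
  rw [inst_subst, eval]
  congr 1
  exact (Function.comp_update some g x a).symm

theorem term_inst_rename (t : Term σ) :
    (t.rename S.emb).inst (fun x => some (g x)) = .const (S.canonicalModel.den g t) := by
  cases t <;> rfl

theorem sat_iff_eval_mem (φ : Formula σ) (w : S.World) (hg : ∀ x, g x ∈ w.dom) :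
    S.canonicalModel.Sat w g φ ↔ S.eval g φ ∈ w.thy := by
  induction φ generalizing w g with
  | rel P ts => simp only [eval, rename, inst, term_inst_rename]; exact Iff.rfl
  | eq s t => simp only [eval, rename, inst, term_inst_rename]; exact Iff.rfl
  | and φ ψ ihφ ihψ => exact (and_congr (ihφ w hg) (ihψ w hg)).trans w.primeTheory.and_mem_iff.symm
  | or φ ψ ihφ ihψ =>
    exact (or_congr (ihφ w hg) (ihψ w hg)).trans
      (w.primeTheory.or_mem_iff (eval_mem_sentences hg (φ.or ψ))).symm
  | imp φ ψ ihφ ihψ =>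
    refine Iff.trans (forall₂_congr fun w' hw => ?_)
      (World.imp_mem_iff (eval_mem_sentences hg (φ.imp ψ))).symm
    have hg' := fun x => World.dom_subset hw (hg x)
    exact imp_congr (ihφ w' hg') (ihψ w' hg')
  | box φ ih =>
    refine Iff.trans (forall₄_congr fun w' v hw hv => ?_)
      (World.box_mem_iff (eval_mem_sentences hg (box φ))).symm
    exact ih v fun x => World.M.dom_subset hv (World.dom_subset hw (hg x))
  | dia φ ih =>
    refine Iff.trans (exists_congr fun v => and_congr_right fun hv => ?_)
      (World.dia_mem_iff (eval_mem_sentences hg (dia φ))).symm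
    exact ih v fun x => World.M.dom_subset hv (hg x)
  | all x φ ih =>
    refine Iff.trans (forall₄_congr fun w' hw a ha => ?_)
      (World.all_mem_iff (eval_mem_sentences hg (all x φ))).symm
    exact subst_inst_update (S := S) (g := g) x a φ ▸
      ih w' (World.update_mem_dom (fun y => World.dom_subset hw (hg y)) ha)
  | ex x φ ih =>
    refine Iff.trans (exists_congr fun a => and_congr_right fun ha => ?_)
      (w.primeTheory.ex_mem_iff (eval_mem_sentences hg (ex x φ))).symm
    exact subst_inst_update (S := S) (g := g) x a φ ▸ ih w (World.update_mem_dom hg ha)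
  | bot => exact ⟨False.elim, w.primeTheory.bot_notMem⟩

theorem holds_iff_rename_mem {φ : Formula σ} (hφ : φ.IsSentence) (w : S.World) :
    S.canonicalModel.Holds w φ ↔ φ.rename S.emb ∈ w.thy := by
  have hsat (g : ℕ → σ.Const) (hg : ∀ x, g x ∈ w.dom) :
      S.canonicalModel.Sat w g φ ↔ φ.rename S.emb ∈ w.thy := by
    rw [sat_iff_eval_mem φ w hg, eval_eq_rename hφ]
  have := σ.infinite_const
  obtain ⟨c⟩ : Nonempty σ.Const := inferInstance
  exact ⟨fun h => (hsat (fun _ => S.emb c) fun _ => w.emb_mem_dom c).1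
    (h _ fun _ => w.emb_mem_dom c), fun h g hg => (hsat g hg).2 h⟩

end Stratification

theorem Proves.of_rename {Γ : Set (Formula σ)} {φ : Formula σ} {f : σ.Const → σ.Const}
    (hf : Function.Injective f) (h : Proves (Formula.rename f '' Γ) (φ.rename f)) :
    Proves Γ φ := by
  have := σ.infinite_const
  have hinv (ψ : Formula σ) : (ψ.rename f).rename (Function.invFun f) = ψ := by
    rw [rename_rename, Function.invFun_comp hf, rename_id]
  have h' := h.rename (Function.invFun f)
  rw [hinv, Set.image_image] at h'
  simpa only [hinv, Set.image_id'] using h'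

end FOFS

theorem mainTheorem1 (σ : FOFS.Signature.{u}) (Γ : Set (FOFS.Formula σ))
    (hΓ : ∀ γ ∈ Γ, γ.IsSentence) (φ : FOFS.Formula σ) (hφ : φ.IsSentence)
    (h : FOFS.Entails Γ φ) : FOFS.Proves Γ φ := by
  obtain ⟨S⟩ := FOFS.nonempty_stratification σ
  refine FOFS.Proves.of_rename S.emb_injective ?_
  by_contra hnot
  have hΓS : FOFS.Formula.rename S.emb '' Γ ⊆ FOFS.Formula.sentences (S.consts 0 0) :=
    Set.image_subset_iff.2 fun γ hγ => S.rename_mem_sentences (hΓ γ hγ) 0 0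
  obtain ⟨w, hΓw, hφw⟩ :=
    FOFS.Stratification.World.exists_root hΓS (S.rename_mem_sentences hφ 0 0) hnot
  have hholds : ∀ γ ∈ Γ, S.canonicalModel.Holds w γ := fun γ hγ =>
    (FOFS.Stratification.holds_iff_rename_mem (hΓ γ hγ) w).2 (hΓw (Set.mem_image_of_mem _ hγ))
  exact hφw ((FOFS.Stratification.holds_iff_rename_mem hφ w).1 (h S.canonicalModel w hholds))
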